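/- **Setting.** Let $1\le q\le r$ and $m\ge 1$ be integers and $\mathcal X=[0,1]^r$. Let $\mathbb S_m$ be the Sobolev space of functions $f:[0,1]\to\mathbb R$ such that $f^{(m-1)}$ exists and is absolutely continuous and $f^{(m)}\in L_2[0,1]$, with inner product $$\langle f,g\rangle_{\mathbb S_m}=\sum_{k=0}^{m-1}\int_0^1\!\!\int_0^1 f^{(k)}(x)g^{(k)}(y)\,dx\,dy+\int_0^1 f^{(m)}(x)g^{(m)}(x)\,dx ,$$ and let $\mathbb S_m^{(0)}=\{f\in\mathbb S_m:\int_0^1 f=0\}$. Let $\mathcal H_q$ be the space of functions on $\mathcal X$ $$\mathcal H_q=\bigoplus_{A\subseteq\{1,\dots,r\},\,|A|\le q}\ \bigotimes_{s\in A}\mathbb S_m^{(0)}(x_s)$$ (the summand for $A=\emptyset$ being the constants), that is, the completion, as a space of functions on $\mathcal X$, of the finite sums of products $\prod_{s=1}^r\varphi_s(x_s)$ with $\varphi_s\in\mathbb S_m^{(0)}$ for $s\in A$ and $\varphi_s=1$ for $s\notin A$, $|A|\le q$, under the inner product determined by $\langle\prod_s\varphi_s,\prod_s\gamma_s\rangle_{\mathcal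 H_q}=\prod_s\langle\varphi_s,\gamma_s\rangle_{\mathbb S_m}$. Let $(\mathbf X_i,\epsilon_i)$, $i\ge 1$, be i.i.d. with $\mathbf X_i\in\mathcal X$ having density $\pi_{\mathbf X}$, let $f_0\in\mathcal H_q$ and $Y_i=f_0(\mathbf X_i)+\epsilon_i$. Let $\lambda=\lambda_n>0$ be deterministic and let $$\widehat f=\operatorname*{argmin}_{f\in\mathcal H_q}\Big\{\frac1{2n}\sum_{i=1}^n(Y_i-f(\mathbf X_i))^2+\frac\lambda2\|f\|_{\mathcal H_q}^2\Big\}.$$ Write $\langle f,g\rangle_{L_2}=\int_{\mathcal X}fg\,\pi_{\mathbf X}$ and $\mathbb I_q=\{\mathbf i\in\{1,2,\dots\}^r:\#\{k:i_k>1\}\le q\}$. Let $\rho_{\mathbf i}>0$ and $\psi_{\mathbf i}\in\mathcal H_q$, $\mathbf i\in\mathbb I_q$, be eigenvalues and eigenfunctions, i.e. $\langle\psi_{\mathbf i},g\rangle_{L_2}=\rho_{\mathbf i}\langle\psi_{\mathbf i},g\rangle_{\mathcal H_q}$ for all $g\in\mathcal H_q$, with $\langle\psi_{\mathbf i},\psi_{\mathbf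 j}\rangle_{L_2}=\delta_{\mathbf i\mathbf j}$, $\langle\psi_{\mathbf i},\psi_{\mathbf j}\rangle_{\mathcal H_q}=\delta_{\mathbf i\mathbf j}/\rho_{\mathbf i}$, such that the $\psi_{\mathbf i}$ form an orthonormal basis of $\mathcal H_q$ with respect to $\langle\cdot,\cdot\rangle_{L_2}$. For $\boldsymbol\beta\in\{0,1,2,\dots\}^r$ let $\mathbf i^{\boldsymbol\beta}=\prod_k i_k^{\beta_k}$, $\partial^{\boldsymbol\beta}=\partial^{|\boldsymbol\beta|}/\partial x_1^{\beta_1}\cdots\partial x_r^{\beta_r}$, and $$h_{\boldsymbol\beta}=\Big(\sum_{\mathbf i\in\mathbb I_q}\frac{\mathbf i^{\boldsymbol\beta}}{1+\lambda/\rho_{\mathbf i}}\Big)^{-1},\qquad h=h_{\mathbf 0},$$ where $h_{\boldsymbol\beta}=0$ (and $1/h_{\boldsymbol\beta}=\infty$) if the sum diverges. **Assumptions.** (1) There is $C_\pi\ge1$ with $C_\pi^{-1}\le\pi_{\mathbf X}\le C_\pi$ on $\mathcal X$. For some $\sigma,C_\sigma>0$: $\mathbb P(|\epsilon_i|>t)\le2\exp\{-t^2/(2\sigma^2)\}$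 for all $t>0$, and almost surely $\mathbb E(\epsilon_i\mid\mathbf X_i)=0$, $\mathbb E(\epsilon_i^2\mid\mathbf X_i)\ge C_\sigma^{-1}$ and $\mathbb E(\epsilon_i^k\mid\mathbf X_i)\le C_\sigma^k$ for $k=1,2,3,4$. (2) There is $C_\psi>0$ with $\sup_{\mathcal X}|\psi_{\mathbf i}|\le C_\psi$ and $\sup_{\mathcal X}|\partial^{\boldsymbol\beta}\psi_{\mathbf i}|\le C_\psi\,\mathbf i^{\boldsymbol\beta}$ for all $\mathbf i\in\mathbb I_q$, where $\boldsymbol\beta$ is the multi-index of the theorem. **Theorem.** Let $\boldsymbol\beta\in\{0,1,2,\dots\}^r$ with $\max_s\beta_s\le m-1$. If (1) and (2) hold, $nh^2\to\infty$ and $\lambda\to0$ as $n\to\infty$, then $$\|\partial^{\boldsymbol\beta}\widehat f-\partial^{\boldsymbol\beta}f_0\|_{\sup}^2=O_P\Big(\frac{\lambda}{h_{2\boldsymbol\beta}}+\frac1{n\,h\,h_{2\boldsymbol\beta}}\Big),$$ where $\|\cdot\|_{\sup}$ is the supremum norm over $\mathcal X$, and $Z_n=O_P(a_n)$ means that for every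 $\delta>0$ there is $C$ with $\mathbb P(Z_n>Ca_n)\le\delta$ for all large $n$. -/

import Mathlib

open MeasureTheory ProbabilityTheory Filter Topology
open scoped ENNReal NNReal

namespace SSANOVA

noncomputable section

/-- The covariate domain `[0,1]^r`. Functions on it are represented by functions on `Fin r → ℝ`
of which only the values on the cube matter. -/
def cube (r : ℕ) : Set (Fin r → ℝ) := Set.univ.pi fun _ => Set.Icc (0 : ℝ) 1

/-! ### The univariate Sobolev space -/

/-- `f ^ (k)` on `[0,1]` (one-sided at the end points). -/
def der (k : ℕ) (f : ℝ → ℝ) : ℝ → ℝ := iteratedDerivWithin k f (Set.Icc 0 1)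

/-- The Sobolev space `S_m` on `[0,1]`, for `m ≥ 1`: `f` is `C^(m-1)`, `f^(m-1)` is absolutely
continuous and `f^(m)` (which then exists almost everywhere) is square integrable. -/
def Sobolev (m : ℕ) : Set (ℝ → ℝ) :=
  {f | ContDiffOn ℝ ((m - 1 : ℕ) : ℕ∞) f (Set.Icc 0 1) ∧
    AbsolutelyContinuousOnInterval (der (m - 1) f) 0 1 ∧
    MemLp (der m f) 2 (volume.restrict (Set.Icc (0 : ℝ) 1))}

/-- `⟨f, g⟩ = ∑_{k<m} ∫∫ f^(k)(x) g^(k)(y) dx dy + ∫ f^(m) g^(m)`. -/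
def sobolevInner (m : ℕ) (f g : ℝ → ℝ) : ℝ :=
  (∑ k ∈ Finset.range m, ∫ x in (0 : ℝ)..1, ∫ y in (0 : ℝ)..1, der k f x * der k g y) +
    ∫ x in (0 : ℝ)..1, der m f x * der m g x

/-- The subspace of `S_m` of functions with mean zero. -/
def Sobolev0 (m : ℕ) : Set (ℝ → ℝ) := {f | f ∈ Sobolev m ∧ ∫ x in (0 : ℝ)..1, f x = 0}

/-! ### The tensor product space `H_q`

Formal finite linear combinations of products `∏ s, φ s (x s)` carry the tensor product form;
`H_q` is the completion, realized as a space of functions on the cube. -/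

/-- The factors of a product function belonging to one of the spaces
`⊗_{s ∈ A} S_m^(0)(x_s)` with `|A| ≤ q` (the space of constants when `A = ∅`). -/
def IsElementary {r : ℕ} (m q : ℕ) (φ : Fin r → ℝ → ℝ) : Prop :=
  ∃ A : Finset (Fin r), A.card ≤ q ∧ (∀ s ∈ A, φ s ∈ Sobolev0 m) ∧ ∀ s ∉ A, φ s = fun _ => 1

/-- Formal finite linear combinations of product functions. -/
abbrev FormalSum (r : ℕ) : Type := (Fin r → ℝ → ℝ) →₀ ℝ

/-- The function that a formal sum stands for. -/
def FormalSum.eval {r : ℕ} (F : FormalSum r) (x : Fin r → ℝ) : ℝ :=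
  F.sum fun φ c => c * ∏ s, φ s (x s)

/-- The bilinear extension of `⟨∏ φ_s, ∏ γ_s⟩ = ∏ ⟨φ_s, γ_s⟩`. Products belonging to different
sets `A` are orthogonal, since constants are orthogonal to mean zero functions in `S_m`. -/
def FormalSum.form {r : ℕ} (m : ℕ) (F G : FormalSum r) : ℝ :=
  F.sum fun φ a => G.sum fun γ b => a * b * ∏ s, sobolevInner m (φ s) (γ s)

/-- `F` is a Cauchy sequence of finite sums of elementary products that converges to `f`
pointwise on the cube. -/
structure Approximates {r : ℕ} (m q : ℕ) (F : ℕ → FormalSum r) (f : (Fin r → ℝ) → ℝ) : Prop where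
  elementary : ∀ k, ∀ φ ∈ (F k).support, IsElementary m q φ
  cauchy : ∀ η > 0, ∃ N, ∀ k ≥ N, ∀ l ≥ N, FormalSum.form m (F k - F l) (F k - F l) < η
  tendsto : ∀ x ∈ cube r, Tendsto (fun k => (F k).eval x) atTop (𝓝 (f x))

/-- The SS-ANOVA space `H_q`. -/
def Hq (r m q : ℕ) : Set ((Fin r → ℝ) → ℝ) := {f | ∃ F, Approximates m q F f}

/-- `c` is the limit of the inner products along approximating sequences of `f` and `g`. -/
def HasInner {r : ℕ} (m q : ℕ) (f g : (Fin r → ℝ) → ℝ) (c : ℝ) : Prop :=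
  ∃ F G, Approximates m q F f ∧ Approximates m q G g ∧
    Tendsto (fun k => FormalSum.form m (F k) (G k)) atTop (𝓝 c)

/-- The inner product of `H_q`: the number `c` with `HasInner m q f g c`, which exists and is
unique for `f, g ∈ H_q`. -/
def innerHq {r : ℕ} (m q : ℕ) (f g : (Fin r → ℝ) → ℝ) : ℝ := Classical.epsilon (HasInner m q f g)

/-! ### Partial derivatives and the supremum norm -/

/-- `∂^k f / ∂x_s^k` on the cube (one-sided on the faces). -/
def partialDer {r : ℕ} (s : Fin r) (k : ℕ) (f : (Fin r → ℝ) → ℝ) : (Fin r → ℝ) → ℝ :=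
  fun x => iteratedDerivWithin k (fun t => f (Function.update x s t)) (Set.Icc 0 1) (x s)

/-- `∂^β f = ∂^|β| f / ∂x_1^β_1 … ∂x_r^β_r`. -/
def mixedDer {r : ℕ} (β : Fin r → ℕ) (f : (Fin r → ℝ) → ℝ) : (Fin r → ℝ) → ℝ :=
  (List.finRange r).foldr (fun s g => partialDer s (β s) g) f

/-- The supremum norm over the cube. -/
def supNorm {r : ℕ} (f : (Fin r → ℝ) → ℝ) : ℝ≥0∞ := ⨆ x ∈ cube r, ENNReal.ofReal |f x|

/-! ### The eigensystem and the effective dimensions -/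

/-- `⟨f, g⟩_{L_2} = ∫ f g π` for the covariate density `π`. -/
def innerL2 {r : ℕ} (π f g : (Fin r → ℝ) → ℝ) : ℝ := ∫ x in cube r, f x * g x * π x

/-- Multi-indices of positive integers with at most `q` entries greater than one. -/
abbrev MultiIdx (r q : ℕ) : Type :=
  {i : Fin r → ℕ+ // (Finset.univ.filter fun k => 1 < i k).card ≤ q}

/-- `i^β = ∏ i_k^β_k`. -/
def idxPow {r q : ℕ} (i : MultiIdx r q) (β : Fin r → ℕ) : ℝ := ∏ k, ((i.1 k : ℕ) : ℝ) ^ β k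

/-- Eigenvalues `ρ_i` and eigenfunctions `ψ_i` that diagonalize the inner products of `L_2(π)` and
`H_q` simultaneously and form an orthonormal basis of `H_q` with respect to `L_2(π)`
(Parseval's identity). -/
structure IsEigensystem {r : ℕ} (m q : ℕ) (π : (Fin r → ℝ) → ℝ)
    (ρ : MultiIdx r q → ℝ) (ψ : MultiIdx r q → (Fin r → ℝ) → ℝ) : Prop where
  mem : ∀ i, ψ i ∈ Hq r m q
  pos : ∀ i, 0 < ρ i
  eigen : ∀ i, ∀ g ∈ Hq r m q, innerL2 π (ψ i) g = ρ i * innerHq m q (ψ i) g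
  orthoL2 : ∀ i j, innerL2 π (ψ i) (ψ j) = if i = j then 1 else 0
  orthoHq : ∀ i j, innerHq m q (ψ i) (ψ j) = if i = j then 1 / ρ i else 0
  basis : ∀ f ∈ Hq r m q, HasSum (fun i => innerL2 π f (ψ i) ^ 2) (innerL2 π f f)

/-- `h_β = (∑_i i^β / (1 + λ / ρ_i))⁻¹`, with value `0` if the sum diverges. -/
def hh {r q : ℕ} (ρ : MultiIdx r q → ℝ) (lam : ℝ) (β : Fin r → ℕ) : ℝ≥0∞ :=
  (∑' i : MultiIdx r q, ENNReal.ofReal (idxPow i β / (1 + lam / ρ i)))⁻¹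

/-! ### Assumptions, estimator, stochastic order -/

/-- The assumptions on the covariate vector `X` with density `π` and on the noise `ε`. -/
structure DistributionAssumption {Ω : Type*} [MeasurableSpace Ω] (P : Measure Ω) {r : ℕ}
    (X : Ω → Fin r → ℝ) (ε : Ω → ℝ) (π : (Fin r → ℝ) → ℝ) (Cπ σ Cσ : ℝ) : Prop where
  measurable_X : Measurable X
  measurable_ε : Measurable ε
  measurable_π : Measurable π
  density : P.map X = (volume.restrict (cube r)).withDensity fun x => ENNReal.ofReal (π x)
  density_bounds : ∀ x ∈ cube r, Cπ⁻¹ ≤ π x ∧ π x ≤ Cπ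
  subGaussian : ∀ t > 0, P {ω | t < |ε ω|} ≤ ENNReal.ofReal (2 * Real.exp (-t ^ 2 / (2 * σ ^ 2)))
  condMean : P[ε | MeasurableSpace.comap X inferInstance] =ᵐ[P] 0
  condVar : ∀ᵐ ω ∂P, Cσ⁻¹ ≤ (P[fun ω' => ε ω' ^ 2 | MeasurableSpace.comap X inferInstance]) ω
  condMoment : ∀ k ∈ Finset.Icc 1 4, ∀ᵐ ω ∂P,
    (P[fun ω' => ε ω' ^ k | MeasurableSpace.comap X inferInstance]) ω ≤ Cσ ^ k

/-- The bounds on the eigenfunctions and on their derivatives of order `β`. -/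
def EigenfunctionAssumption {r q : ℕ} (ψ : MultiIdx r q → (Fin r → ℝ) → ℝ) (β : Fin r → ℕ)
    (Cψ : ℝ) : Prop :=
  ∀ i, ∀ x ∈ cube r, |ψ i x| ≤ Cψ ∧ |mixedDer β (ψ i) x| ≤ Cψ * idxPow i β

/-- The penalized least squares criterion. -/
def krrObjective {r n : ℕ} (m q : ℕ) (lam : ℝ) (x : Fin n → Fin r → ℝ) (y : Fin n → ℝ)
    (f : (Fin r → ℝ) → ℝ) : ℝ :=
  1 / (2 * (n : ℝ)) * ∑ i, (y i - f (x i)) ^ 2 + lam / 2 * innerHq m q f f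

/-- `f` is the kernel ridge regression estimator: it minimizes the criterion over `H_q`. -/
def IsKRR {r n : ℕ} (m q : ℕ) (lam : ℝ) (x : Fin n → Fin r → ℝ) (y : Fin n → ℝ)
    (f : (Fin r → ℝ) → ℝ) : Prop :=
  f ∈ Hq r m q ∧ ∀ g ∈ Hq r m q, krrObjective m q lam x y f ≤ krrObjective m q lam x y g

/-- `Z_n = O_P(a_n)`. -/
def IsBigOP {Ω : Type*} [MeasurableSpace Ω] (P : Measure Ω) (Z : ℕ → Ω → ℝ≥0∞)
    (a : ℕ → ℝ≥0∞) : Prop :=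
  ∀ δ : ℝ≥0∞, 0 < δ → ∃ C : ℝ≥0, ∀ᶠ n in atTop, P {ω | (C : ℝ≥0∞) * a n < Z n ω} ≤ δ

end

end SSANOVA

namespace SSANOVA

noncomputable section

/-! Write w_i = 1 / (1 + λ/ρ_i), so that ∑ w_i = 1/h, and ‖f‖_λ² = ‖f‖²_{L_2} + λ‖f‖²_{H_q}
(`penNormSq`). In the eigenbasis ‖f‖_λ² = ∑ f_i² / w_i with f_i = ⟨f, ψ_i⟩_{L_2}. Hence anything
that is a series in the coefficients of Δ = f̂ − f₀ is controlled by ‖Δ‖_λ through weighted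
Cauchy-Schwarz (`sq_le_mul_of_hasSum`). This is used three times: the noise term is at most ‖Δ‖_λ
times the root of ∑ w_j (noise on ψ_j)²; the gap between empirical and population norm of Δ is at
most ‖Δ‖_λ² times a Hilbert-Schmidt distance; and |∂^β Δ(x)|² ≤ ‖Δ‖_λ² · Cψ² ∑ w_i i^{2β}, which is
‖Δ‖_λ² Cψ² / h_{2β}.

Comparing the criterion at f̂ and f₀ gives, once the Hilbert-Schmidt distance is at most 1/2, the
bound ‖Δ‖_λ² ≤ 32 (N + λ‖f₀‖²), where N bounds the squared dual norm of the noise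
(`IsEigensystem.penNormSq_sub_le`). Both random quantities are sums of squared centred averages, so
their means are at most constants times 1/(n h²) and 1/(n h). Markov's inequality finishes the
proof; uniformity in x is already contained in the Cauchy-Schwarz step, so no chaining is needed.

The analytic work is to justify these expansions for H_q as a completion of formal sums. S_m is
embedded isometrically in ℝ^m × L², where point evaluations and derivatives up to order m − 1 have
representing vectors (`jetModel`). A tensor power is obtained from the product kernel
(`exists_tensorPower`), and H_q becomes a closed subspace of it in which a vector is determined by
its function (`eq_zero_of_forall_derRep`). The scaled eigenfunctions are a Hilbert basis there
(`IsEigensystem.hasSum_represents`), and bounded functionals can be applied term by term. -/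

/-! ### A Hilbert space model of the univariate Sobolev space -/

/-- A Hilbert space `E` with an isometric copy `emb` of the Sobolev space in which the point
evaluations and their derivatives are represented by vectors `rep k t`, the vectors `rep 0 t`,
`0 ≤ t ≤ 1`, being total. -/
structure SobolevModel (m : ℕ) (E : Type*) [NormedAddCommGroup E] [InnerProductSpace ℝ E] where
  emb : (ℝ → ℝ) → E
  rep : ℕ → ℝ → E
  inner_emb : ∀ f ∈ Sobolev m, ∀ g ∈ Sobolev m, inner ℝ (emb f) (emb g) = sobolevInner m f g
  inner_emb_rep : ∀ f ∈ Sobolev m, ∀ t ∈ Set.Icc (0 : ℝ) 1, inner ℝ (emb f) (rep 0 t) = f t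
  hasDerivAt_rep : ∀ k, k + 1 ≤ m - 1 → ∀ t, HasDerivAt (rep k) (rep (k + 1) t) t
  continuous_rep : ∀ k ≤ m - 1, Continuous (rep k)
  total : ∀ u, (∀ t ∈ Set.Icc (0 : ℝ) 1, inner ℝ u (rep 0 t) = 0) → u = 0

lemma uniqueDiffOn_unitInterval : UniqueDiffOn ℝ (Set.Icc (0 : ℝ) 1) :=
  uniqueDiffOn_Icc one_pos

lemma der_succ (k : ℕ) (f : ℝ → ℝ) : der (k + 1) f = derivWithin (der k f) (Set.Icc 0 1) :=
  iteratedDerivWithin_succ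

lemma derivWithin_ae_eq_deriv (g : ℝ → ℝ) :
    ∀ᵐ y : ℝ, y ∈ Set.Icc (0 : ℝ) 1 → derivWithin g (Set.Icc 0 1) y = deriv g y := by
  have h0 : ∀ᵐ y : ℝ, y ≠ 0 := by simp [ae_iff, measure_singleton]
  have h1 : ∀ᵐ y : ℝ, y ≠ 1 := by simp [ae_iff, measure_singleton]
  filter_upwards [h0, h1] with y hy0 hy1 hy
  exact derivWithin_of_mem_nhds (Icc_mem_nhds (lt_of_le_of_ne hy.1 hy0.symm)
    (lt_of_le_of_ne hy.2 hy1))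

lemma intervalIntegral_derivWithin (g : ℝ → ℝ) (w : ℝ → ℝ) {a b : ℝ} (ha : 0 ≤ a) (hab : a ≤ b)
    (hb : b ≤ 1) :
    ∫ y in a..b, w y * derivWithin g (Set.Icc 0 1) y = ∫ y in a..b, w y * deriv g y := by
  apply intervalIntegral.integral_congr_ae
  filter_upwards [derivWithin_ae_eq_deriv g] with y hy hy'
  rw [Set.uIoc_of_le hab] at hy'
  rw [hy ⟨ha.trans hy'.1.le, hy'.2.trans hb⟩]

/-- Recovering an absolutely continuous function from its mean and its derivative. -/
lemma AbsolutelyContinuousOnInterval.eq_mean_add {g : ℝ → ℝ}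
    (hg : AbsolutelyContinuousOnInterval g 0 1) {t : ℝ} (ht : t ∈ Set.Icc (0 : ℝ) 1) :
    g t = (∫ y in (0 : ℝ)..1, g y) + (∫ y in (0 : ℝ)..1, y * derivWithin g (Set.Icc 0 1) y) -
      ∫ y in t..1, derivWithin g (Set.Icc 0 1) y := by
  have h1 := intervalIntegral_derivWithin g (fun y => y) le_rfl zero_le_one le_rfl
  have h2 := intervalIntegral_derivWithin g (fun _ => 1) ht.1 ht.2 le_rfl
  simp only [one_mul] at h2
  have hid : AbsolutelyContinuousOnInterval (fun y : ℝ => y) 0 1 :=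
    ContDiffOn.absolutelyContinuousOnInterval contDiffOn_id
  have hg' : AbsolutelyContinuousOnInterval g t 1 :=
    hg.mono (Set.uIcc_subset_uIcc (by simpa [Set.uIcc_of_le] using ht) (by simp))
  -- Integration by parts gives ∫ y g' = g(1) − ∫ g, and ∫_t^1 g' = g(1) − g(t).
  rw [h1, h2, hid.integral_mul_deriv_eq_deriv_mul hg, hg'.integral_deriv_eq_sub]
  simp

lemma Sobolev.absolutelyContinuous {m : ℕ} {f : ℝ → ℝ} (hf : f ∈ Sobolev m) {k : ℕ}
    (hk : k ≤ m - 1) : AbsolutelyContinuousOnInterval (der k f) 0 1 := by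
  rcases hk.eq_or_lt with rfl | hk
  · exact hf.2.1
  apply ContDiffOn.absolutelyContinuousOnInterval
  rw [Set.uIcc_of_le zero_le_one]
  have h : ContDiffOn ℝ (k + 1 : ℕ) f (Set.Icc 0 1) := hf.1.of_le (by exact_mod_cast hk)
  exact ((contDiffOn_nat_succ_iff_contDiffOn_one_iteratedDerivWithin
    uniqueDiffOn_unitInterval).1 h).2

/-- Lebesgue measure on the unit interval. -/
abbrev unitMeasure : Measure ℝ := volume.restrict (Set.Icc (0 : ℝ) 1)

lemma Sobolev.memLp {m : ℕ} {f : ℝ → ℝ} (hf : f ∈ Sobolev m) : MemLp (der m f) 2 unitMeasure :=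
  hf.2.2

/-- The space `ℝ^m × L²[0,1]`. -/
abbrev JetSpace (m : ℕ) : Type := WithLp 2 (EuclideanSpace ℝ (Fin m) × Lp ℝ 2 unitMeasure)

/-- The vector of `JetSpace m` with components `c` and `v`. -/
def jet {m : ℕ} (c : Fin m → ℝ) (v : Lp ℝ 2 unitMeasure) : JetSpace m :=
  WithLp.toLp 2 (WithLp.toLp 2 c, v)

@[simp]
lemma jet_fst {m : ℕ} (c : Fin m → ℝ) (v : Lp ℝ 2 unitMeasure) (i : Fin m) :
    (jet c v).fst i = c i := rfl

@[simp]
lemma jet_snd {m : ℕ} (c : Fin m → ℝ) (v : Lp ℝ 2 unitMeasure) : (jet c v).snd = v := rfl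

lemma inner_jet {m : ℕ} (u : JetSpace m) (d : Fin m → ℝ) (w : Lp ℝ 2 unitMeasure) :
    inner ℝ u (jet d w) = (∑ i, u.fst i * d i) + inner ℝ u.snd w := by
  rw [WithLp.prod_inner_apply]
  simp [jet, PiLp.inner_apply, mul_comm]

/-- The standard basis vectors of the first component. -/
def jetBasis (m k : ℕ) : JetSpace m := jet (fun i => if (i : ℕ) = k then 1 else 0) 0

lemma inner_jetBasis {m k : ℕ} (u : JetSpace m) (hk : k < m) :
    inner ℝ u (jetBasis m k) = u.fst ⟨k, hk⟩ := by
  rw [jetBasis, inner_jet, inner_zero_right, add_zero, Finset.sum_eq_single ⟨k, hk⟩]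
  · simp
  · intro i _ hi
    rw [if_neg (fun h => hi (Fin.ext h)), mul_zero]
  · simp

lemma memLp_id_unitMeasure : MemLp (fun y : ℝ => y) 2 unitMeasure := by
  refine MemLp.of_bound measurable_id.aestronglyMeasurable 1 ?_
  filter_upwards [ae_restrict_mem measurableSet_Icc] with y hy
  simpa [abs_of_nonneg hy.1] using hy.2

/-- The function `y ↦ y - 1_{y > t}` of `L²[0,1]`. -/
def kink (t : ℝ) : Lp ℝ 2 unitMeasure :=
  memLp_id_unitMeasure.toLp - indicatorConstLp 2 (measurableSet_Ioi (a := t)) (measure_ne_top _ _) 1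

lemma continuous_kink : Continuous kink := by
  refine continuous_const.sub (continuous_indicatorConstLp_set (by simp) fun t => ?_)
  have h : ∀ s, unitMeasure (symmDiff (Set.Ioi s) (Set.Ioi t)) ≤ ENNReal.ofReal |s - t| := by
    intro s
    refine (Measure.restrict_apply_le _ _).trans ?_
    refine (measure_mono (t := Set.uIoc s t) ?_).trans ?_
    · intro y hy
      rcases hy with ⟨h1, h2⟩ | ⟨h1, h2⟩
      · exact Set.mem_uIoc.2 (Or.inl ⟨h1, not_lt.1 h2⟩)
      · exact Set.mem_uIoc.2 (Or.inr ⟨h1, not_lt.1 h2⟩)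
    · rw [Real.volume_uIoc, abs_sub_comm]
  refine tendsto_of_tendsto_of_tendsto_of_le_of_le tendsto_const_nhds ?_ (fun _ => zero_le) h
  have : Continuous fun s : ℝ => ENNReal.ofReal |s - t| :=
    ENNReal.continuous_ofReal.comp (by fun_prop)
  simpa using this.tendsto t

lemma intervalIntegral_unit (g : ℝ → ℝ) : ∫ y in (0 : ℝ)..1, g y = ∫ y, g y ∂unitMeasure := by
  rw [intervalIntegral.integral_of_le zero_le_one, integral_Icc_eq_integral_Ioc]

/-- This is the part of `AbsolutelyContinuousOnInterval.eq_mean_add` that involves the derivative,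
read as an inner product with v in the role of f^(m). -/
lemma inner_kink (v : Lp ℝ 2 unitMeasure) {t : ℝ} (ht : t ∈ Set.Icc (0 : ℝ) 1) :
    inner ℝ v (kink t) = (∫ y in (0 : ℝ)..1, y * v y) - ∫ y in t..1, v y := by
  rw [kink, inner_sub_right]
  congr 1
  · rw [L2.inner_def, intervalIntegral_unit]
    apply integral_congr_ae
    filter_upwards [memLp_id_unitMeasure.coeFn_toLp] with y hy
    simp [hy]
  · rw [real_inner_comm, L2.inner_indicatorConstLp_one,
      Measure.restrict_restrict measurableSet_Ioi, intervalIntegral.integral_of_le ht.2]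
    congr 2
    ext y
    simp only [Set.mem_inter_iff, Set.mem_Ioi, Set.mem_Icc, Set.mem_Ioc]
    constructor
    · rintro ⟨h1, h2⟩; exact ⟨h1, h2.2⟩
    · rintro ⟨h1, h2⟩; exact ⟨h1, ht.1.trans h1.le, h2⟩

/-- `jetRep m j t` represents `f ↦ f^(m - 1 - j)(t)`. -/
def jetRep (m : ℕ) : ℕ → ℝ → JetSpace m
  | 0, t => jetBasis m (m - 1) + jet 0 (kink t)
  | j + 1, t => jetBasis m (m - 1 - (j + 1)) + (∫ y in (0 : ℝ)..1, y • jetRep m j y) -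
      ∫ y in t..1, jetRep m j y

lemma continuous_jetRep_zero (m : ℕ) : Continuous (jetRep m 0) := by
  have : Continuous fun t => jetBasis m (m - 1) + jet 0 (kink t) := by
    refine continuous_const.add ?_
    refine (WithLp.prod_continuous_toLp 2 _ _).comp (continuous_const.prodMk continuous_kink)
  exact this

lemma hasDerivAt_jetRep_of_continuous {m j : ℕ} (h : Continuous (jetRep m j)) (t : ℝ) :
    HasDerivAt (jetRep m (j + 1)) (jetRep m j t) t := by
  have h1 : HasDerivAt (fun t => ∫ y in t..1, jetRep m j y) (-jetRep m j t) t :=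
    intervalIntegral.integral_hasDerivAt_left (h.intervalIntegrable _ _)
      (h.stronglyMeasurableAtFilter _ _) h.continuousAt
  have h2 := h1.const_sub (jetBasis m (m - 1 - (j + 1)) + ∫ y in (0 : ℝ)..1, y • jetRep m j y)
  rw [neg_neg] at h2
  exact h2

lemma continuous_jetRep (m j : ℕ) : Continuous (jetRep m j) := by
  induction j with
  | zero => exact continuous_jetRep_zero m
  | succ j ih =>
    exact continuous_iff_continuousAt.2 fun t => (hasDerivAt_jetRep_of_continuous ih t).continuousAt

lemma hasDerivAt_jetRep (m j : ℕ) (t : ℝ) : HasDerivAt (jetRep m (j + 1)) (jetRep m j t) t :=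
  hasDerivAt_jetRep_of_continuous (continuous_jetRep m j) t

lemma inner_jetRep_zero {m : ℕ} (hm : 1 ≤ m) (u : JetSpace m) {t : ℝ}
    (ht : t ∈ Set.Icc (0 : ℝ) 1) : inner ℝ u (jetRep m 0 t) =
      u.fst ⟨m - 1, by omega⟩ + (∫ y in (0 : ℝ)..1, y * u.snd y) - ∫ y in t..1, u.snd y := by
  rw [jetRep, inner_add_right, inner_jetBasis u (by omega), inner_jet, inner_kink _ ht]
  simp [add_sub_assoc]

lemma inner_jetRep_succ {m j : ℕ} (hm : 1 ≤ m) (u : JetSpace m) (t : ℝ) :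
    inner ℝ u (jetRep m (j + 1) t) = u.fst ⟨m - 1 - (j + 1), by omega⟩ +
      (∫ y in (0 : ℝ)..1, y * inner ℝ u (jetRep m j y)) -
      ∫ y in t..1, inner ℝ u (jetRep m j y) := by
  have hc := continuous_jetRep m j
  have h1 := (innerSL ℝ u).intervalIntegral_comp_comm
    (f := fun y : ℝ => y • jetRep m j y)
    ((continuous_id.smul hc).intervalIntegrable (μ := volume) 0 1)
  have h2 := (innerSL ℝ u).intervalIntegral_comp_comm (hc.intervalIntegrable (μ := volume) t 1)
  simp only [innerSL_apply_apply, inner_smul_right] at h1 h2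
  rw [jetRep, inner_sub_right, inner_add_right, inner_jetBasis u (by omega), h1, h2]

open Classical in
/-- The vector `(∫ f, …, ∫ f^(m-1); f^(m))` of a function of the Sobolev space. -/
def toJet (m : ℕ) (f : ℝ → ℝ) : JetSpace m :=
  if h : f ∈ Sobolev m then jet (fun i => ∫ x in (0 : ℝ)..1, der i f x) (Sobolev.memLp h).toLp else 0

lemma toJet_of_mem {m : ℕ} {f : ℝ → ℝ} (h : f ∈ Sobolev m) :
    toJet m f = jet (fun i => ∫ x in (0 : ℝ)..1, der i f x) (Sobolev.memLp h).toLp := dif_pos h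

lemma inner_toJet {m : ℕ} {f g : ℝ → ℝ} (hf : f ∈ Sobolev m) (hg : g ∈ Sobolev m) :
    inner ℝ (toJet m f) (toJet m g) = sobolevInner m f g := by
  rw [toJet_of_mem hf, toJet_of_mem hg, inner_jet, sobolevInner, Finset.sum_range]
  congr 1
  · simp
  · rw [jet_snd, L2.inner_def, intervalIntegral_unit]
    apply integral_congr_ae
    filter_upwards [(Sobolev.memLp hf).coeFn_toLp, (Sobolev.memLp hg).coeFn_toLp] with y h1 h2
    simp [h1, h2, mul_comm]

/-- `jetRep` repeats the formula of `AbsolutelyContinuousOnInterval.eq_mean_add`, so both sides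
satisfy the same recursion. The index j counts integrations starting from f^(m-1), whose derivative
is the L² component; this is why the order of the derivative runs downwards. -/
lemma inner_toJet_jetRep {m : ℕ} (hm : 1 ≤ m) {f : ℝ → ℝ} (hf : f ∈ Sobolev m) {j : ℕ}
    (hj : j ≤ m - 1) {t : ℝ} (ht : t ∈ Set.Icc (0 : ℝ) 1) :
    inner ℝ (toJet m f) (jetRep m j t) = der (m - 1 - j) f t := by
  induction j generalizing t with
  | zero =>
    have hae : (⇑((Sobolev.memLp hf).toLp) : ℝ → ℝ) =ᵐ[unitMeasure] der m f := (Sobolev.memLp hf).coeFn_toLp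
    have hsucc : der m f = derivWithin (der (m - 1) f) (Set.Icc 0 1) := by
      rw [← der_succ, Nat.sub_add_cancel hm]
    rw [inner_jetRep_zero hm _ ht, Nat.sub_zero,
      AbsolutelyContinuousOnInterval.eq_mean_add (Sobolev.absolutelyContinuous hf le_rfl) ht,
      ← hsucc, toJet_of_mem hf]
    have hae' : ∀ᵐ y : ℝ, y ∈ Set.Icc (0 : ℝ) 1 → ((Sobolev.memLp hf).toLp) y = der m f y :=
      (ae_restrict_iff' measurableSet_Icc).1 hae
    congr 1
    · congr 1
      apply intervalIntegral.integral_congr_ae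
      filter_upwards [hae'] with y hy hy'
      rw [Set.uIoc_of_le zero_le_one] at hy'
      rw [jet_snd, hy ⟨hy'.1.le, hy'.2⟩]
    · apply intervalIntegral.integral_congr_ae
      filter_upwards [hae'] with y hy hy'
      rw [Set.uIoc_of_le ht.2] at hy'
      exact hy ⟨ht.1.trans hy'.1.le, hy'.2⟩
  | succ j ih =>
    have ih' := fun {t : ℝ} => ih (t := t) (by omega)
    have hsucc : der (m - 1 - j) f = derivWithin (der (m - 1 - (j + 1)) f) (Set.Icc 0 1) := by
      rw [← der_succ]; congr 1; omega
    rw [inner_jetRep_succ hm, AbsolutelyContinuousOnInterval.eq_mean_add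
      (Sobolev.absolutelyContinuous hf (Nat.sub_le _ _)) ht, ← hsucc]
    congr 1
    · congr 1
      · simp [toJet_of_mem hf]
      · apply intervalIntegral.integral_congr
        intro y hy
        rw [Set.uIcc_of_le zero_le_one] at hy
        simp only
        rw [ih' hy]
    · apply intervalIntegral.integral_congr
      intro y hy
      rw [Set.uIcc_of_le ht.2] at hy
      exact ih' ⟨ht.1.trans hy.1, hy.2⟩

/-- A square integrable function all of whose integrals over intervals `[t,1]` vanish is zero. -/
lemma eq_zero_of_forall_integral_eq_zero (v : Lp ℝ 2 unitMeasure)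
    (h : ∀ t ∈ Set.Icc (0 : ℝ) 1, ∫ y in t..1, v y = 0) : v = 0 := by
  have hi : IntervalIntegrable v volume 0 1 := by
    rw [intervalIntegrable_iff_integrableOn_Icc_of_le zero_le_one]
    exact (Lp.memLp v).integrable (by norm_num)
  rw [Lp.eq_zero_iff_ae_eq_zero]
  have h0 : ∀ᵐ y : ℝ, y ≠ 0 := by simp [ae_iff, measure_singleton]
  have h1 : ∀ᵐ y : ℝ, y ≠ 1 := by simp [ae_iff, measure_singleton]
  refine (ae_restrict_iff' measurableSet_Icc).2 ?_
  filter_upwards [h0, h1, hi.ae_hasDerivAt_integral] with y hy0 hy1 hd hy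
  have hd' := hd (by rwa [Set.uIcc_of_le zero_le_one]) 1 (by simp)
  have hloc : (fun x => ∫ t in (1 : ℝ)..x, v t) =ᶠ[𝓝 y] fun _ => 0 := by
    filter_upwards [Icc_mem_nhds (lt_of_le_of_ne hy.1 hy0.symm) (lt_of_le_of_ne hy.2 hy1)] with x hx
    rw [intervalIntegral.integral_symm, h x hx, neg_zero]
  exact hd'.unique ((hasDerivAt_const y (0 : ℝ)).congr_of_eventuallyEq hloc)

/-- An identity that holds on the whole interval can be differentiated, and each differentiation
lowers the index of `jetRep` by one. -/
lemma inner_jetRep_eq_zero {m : ℕ} {u : JetSpace m}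
    {J : ℕ} (h : ∀ t ∈ Set.Icc (0 : ℝ) 1, inner ℝ u (jetRep m J t) = 0) {j : ℕ} (hj : j ≤ J) :
    ∀ t ∈ Set.Icc (0 : ℝ) 1, inner ℝ u (jetRep m j t) = 0 := by
  induction J with
  | zero => rwa [Nat.le_zero.1 hj]
  | succ J ih =>
    rcases hj.eq_or_lt with rfl | hj
    · exact h
    refine ih (fun t ht => ?_) (by omega)
    have h1 : HasDerivAt (fun t => inner ℝ u (jetRep m (J + 1) t)) (inner ℝ u (jetRep m J t)) t := by
      simpa using (hasDerivAt_const t u).inner ℝ (hasDerivAt_jetRep m J t)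
    have h2 : HasDerivWithinAt (fun t => inner ℝ u (jetRep m (J + 1) t)) 0 (Set.Icc 0 1) t :=
      (hasDerivWithinAt_const t (Set.Icc 0 1) (0 : ℝ)).congr_of_mem h ht
    exact (uniqueDiffOn_unitInterval t ht).eq_deriv _ h1.hasDerivWithinAt h2

/-- All levels vanish by differentiation. At level 0, subtracting the value at t = 1 leaves the
integrals of the L² component over [t,1], which kills that component. At t = 1 the last integral in
each recursion is empty and the other one is zero, so each coordinate in ℝ^m is isolated. -/
lemma jetRep_total {m : ℕ} (hm : 1 ≤ m) {u : JetSpace m}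
    (h : ∀ t ∈ Set.Icc (0 : ℝ) 1, inner ℝ u (jetRep m (m - 1) t) = 0) : u = 0 := by
  have hj := fun {j : ℕ} => inner_jetRep_eq_zero h (j := j)
  have hone : (1 : ℝ) ∈ Set.Icc (0 : ℝ) 1 := by simp
  have hlast : u.fst ⟨m - 1, by omega⟩ + (∫ y in (0 : ℝ)..1, y * u.snd y) = 0 := by
    have := hj (Nat.zero_le _) 1 hone
    rw [inner_jetRep_zero hm u hone] at this
    simpa using this
  have hsnd : u.snd = 0 := by
    refine eq_zero_of_forall_integral_eq_zero _ fun t ht => ?_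
    have := hj (Nat.zero_le _) t ht
    rw [inner_jetRep_zero hm u ht, hlast] at this
    simpa using this
  have hfst : ∀ i, u.fst i = 0 := by
    intro i
    have hi := i.2
    by_cases hlt : (i : ℕ) = m - 1
    · have hz : ∫ y in (0 : ℝ)..1, y * u.snd y = 0 := by
        rw [hsnd, intervalIntegral_unit]
        refine (integral_congr_ae (g := fun _ => 0) ?_).trans (integral_zero _ _)
        filter_upwards [Lp.coeFn_zero ℝ 2 unitMeasure] with y hy
        rw [hy, Pi.zero_apply, mul_zero]
      rw [hz, add_zero] at hlast
      rwa [show i = ⟨m - 1, by omega⟩ from Fin.ext hlt]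
    · obtain ⟨j, hjm⟩ : ∃ j, (i : ℕ) = m - 1 - (j + 1) ∧ j + 1 ≤ m - 1 := ⟨m - 1 - i - 1, by omega, by omega⟩
      have h1 := hj hjm.2 1 hone
      rw [inner_jetRep_succ hm] at h1
      have hz : ∫ y in (0 : ℝ)..1, y * inner ℝ u (jetRep m j y) = 0 := by
        refine (intervalIntegral.integral_congr (g := fun _ => 0) ?_).trans (by simp)
        intro y hy
        rw [Set.uIcc_of_le zero_le_one] at hy
        simp only
        rw [hj (by omega) y hy, mul_zero]
      rw [hz, intervalIntegral.integral_same, add_zero, sub_zero] at h1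
      rwa [show i = ⟨m - 1 - (j + 1), by omega⟩ from Fin.ext hjm.1]
  have : inner ℝ u u = 0 := by
    have : u.fst = 0 := by ext i; simp [hfst]
    rw [WithLp.prod_inner_apply]
    simp [hsnd, this]
  simpa using this

/-- The model of the Sobolev space in `ℝ^m × L²[0,1]`. -/
def jetModel {m : ℕ} (hm : 1 ≤ m) : SobolevModel m (JetSpace m) where
  emb := toJet m
  rep k := jetRep m (m - 1 - k)
  inner_emb f hf g hg := inner_toJet hf hg
  inner_emb_rep f hf t ht := by
    rw [Nat.sub_zero, inner_toJet_jetRep hm hf le_rfl ht]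
    simp [der]
  hasDerivAt_rep k hk t := by
    have : m - 1 - k = m - 1 - (k + 1) + 1 := by omega
    rw [this]
    exact hasDerivAt_jetRep m _ t
  continuous_rep k _ := continuous_jetRep m _
  total u h := jetRep_total hm h

/-! ### Hilbert space tensor powers -/

/-- A realization of the `r`-fold tensor power of `E`: product vectors in a Hilbert space `H` whose
inner products are the products of the inner products of the factors. -/
structure TensorPower (r : ℕ) (E H : Type*) [NormedAddCommGroup E] [InnerProductSpace ℝ E]
    [NormedAddCommGroup H] [InnerProductSpace ℝ H] where
  tmul : (Fin r → E) → H
  inner_tmul : ∀ v w, inner ℝ (tmul v) (tmul w) = ∏ s, inner ℝ (v s) (w s)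

lemma posSemidef_inner {X E : Type*} [NormedAddCommGroup E] [InnerProductSpace ℝ E] (v : X → E) :
    (Matrix.of fun a b => inner ℝ (v a) (v b) : Matrix X X ℝ).PosSemidef := by
  refine ⟨Matrix.ext fun a b => by simp [real_inner_comm], fun c => ?_⟩
  have h : (c.sum fun i xi => c.sum fun j xj =>
      star xi * (Matrix.of fun a b => inner ℝ (v a) (v b) : Matrix X X ℝ) i j * xj) =
      inner ℝ (∑ i ∈ c.support, c i • v i) (∑ i ∈ c.support, c i • v i) := by
    simp only [Finsupp.sum, sum_inner, inner_sum, real_inner_smul_left, real_inner_smul_right]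
    refine Finset.sum_congr rfl fun i _ => Finset.sum_congr rfl fun j _ => ?_
    simp only [star_trivial, Matrix.of_apply, real_inner_comm]
    ring
  rw [h]
  exact real_inner_self_nonneg

/-- Schur product theorem: an entrywise product of Gram matrices is positive semidefinite. -/
lemma posSemidef_prod_inner {ι E : Type*} [NormedAddCommGroup E] [InnerProductSpace ℝ E]
    (S : Finset ι) :
    (Matrix.of fun v w => ∏ s ∈ S, inner ℝ (v s) (w s) :
      Matrix (ι → E) (ι → E) ℝ).PosSemidef := by
  classical
  induction S using Finset.induction_on with
  | empty => simpa using posSemidef_inner (fun _ : ι → E => (1 : ℝ))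
  | insert s S hs ih =>
    have h : (Matrix.of fun v w => ∏ s ∈ insert s S, inner ℝ (v s) (w s) :
        Matrix (ι → E) (ι → E) ℝ) = Matrix.hadamard (Matrix.of fun v w => inner ℝ (v s) (w s))
          (Matrix.of fun v w => ∏ s ∈ S, inner ℝ (v s) (w s)) := by
      ext v w
      simp [Finset.prod_insert hs]
    rw [h]
    exact (posSemidef_inner (fun v : ι → E => v s)).hadamard ih

/-- The kernel `∏ s, ⟨v s, w s⟩` on families of vectors. -/
def tensorKernel (r : ℕ) (E : Type*) [NormedAddCommGroup E] [InnerProductSpace ℝ E] :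
    Matrix (Fin r → E) (Fin r → E) (ℝ →L[ℝ] ℝ) :=
  Matrix.of fun v w => (∏ s, inner ℝ (v s) (w s)) • (1 : ℝ →L[ℝ] ℝ)

lemma posSemidef_tensorKernel (r : ℕ) (E : Type*) [NormedAddCommGroup E] [InnerProductSpace ℝ E] :
    (tensorKernel r E).PosSemidef := by
  have htfae := (RKHS.posSemidef_tfae (K := tensorKernel r E)).out 0 2
  refine htfae.2 ⟨Matrix.ext fun v w => ?_, fun c => ?_⟩
  · ext
    simp [tensorKernel, real_inner_comm]
  · have h := (posSemidef_prod_inner (E := E) (Finset.univ : Finset (Fin r))).2 c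
    refine h.trans_eq ?_
    simp only [tensorKernel, Matrix.of_apply, RCLike.re_to_real]
    refine Finsupp.sum_congr fun v _ => Finsupp.sum_congr fun w _ => ?_
    simp only [smul_apply, one_apply_eq_self, smul_eq_mul,
      RCLike.inner_apply, conj_trivial, star_trivial]
    simp_rw [real_inner_comm (v _)]
    ring

/-- In the reproducing kernel Hilbert space of the product kernel, the kernel functions are the
product vectors: the reproducing property is exactly the required formula for inner products. -/
theorem exists_tensorPower (r : ℕ) (E : Type) [NormedAddCommGroup E] [InnerProductSpace ℝ E] :
    ∃ (H : Type) (_ : NormedAddCommGroup H) (_ : InnerProductSpace ℝ H) (_ : CompleteSpace H),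
      Nonempty (TensorPower r E H) := by
  have : Fact (tensorKernel r E).PosSemidef := ⟨posSemidef_tensorKernel r E⟩
  refine ⟨RKHS.OfKernel (tensorKernel r E), inferInstance, inferInstance, inferInstance,
    ⟨fun v => RKHS.kerFun (RKHS.OfKernel (tensorKernel r E)) v 1, fun v w => ?_⟩⟩
  have := RKHS.kernel_inner (RKHS.OfKernel (tensorKernel r E)) w v (1 : ℝ) (1 : ℝ)
  rw [← this, RKHS.OfKernel.kernel_ofKernel]
  simp [tensorKernel, real_inner_comm]

namespace TensorPower

variable {r : ℕ} {E H : Type*} [NormedAddCommGroup E] [InnerProductSpace ℝ E]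
    [NormedAddCommGroup H] [InnerProductSpace ℝ H] (τ : TensorPower r E H)

/-- The squared distance of two product vectors is a polynomial in inner products of their factors.
-/
lemma continuous_tmul : Continuous τ.tmul := by
  refine continuous_iff_continuousAt.2 fun w => tendsto_iff_norm_sub_tendsto_zero.2 ?_
  have h : ∀ v, ‖τ.tmul v - τ.tmul w‖ = √(∏ s, inner ℝ (v s) (v s) -
      2 * ∏ s, inner ℝ (v s) (w s) + ∏ s, inner ℝ (w s) (w s)) := by
    intro v
    rw [norm_eq_sqrt_real_inner, real_inner_sub_sub_self, τ.inner_tmul, τ.inner_tmul, τ.inner_tmul]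
  simp only [h]
  have hc : Continuous fun v : Fin r → E => √(∏ s, inner ℝ (v s) (v s) -
      2 * ∏ s, inner ℝ (v s) (w s) + ∏ s, inner ℝ (w s) (w s)) := by fun_prop
  convert hc.tendsto w using 2
  rw [show ∀ a : ℝ, a - 2 * a + a = 0 by intro a; ring, Real.sqrt_zero]

lemma inner_tmul_update (v w : Fin r → E) (s : Fin r) (a : E) :
    inner ℝ (τ.tmul (Function.update v s a)) (τ.tmul w) =
      inner ℝ a (w s) * ∏ s' ∈ Finset.univ.erase s, inner ℝ (v s') (w s') := by
  rw [τ.inner_tmul, ← Finset.mul_prod_erase _ _ (Finset.mem_univ s), Function.update_self]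
  congr 1
  refine Finset.prod_congr rfl fun s' hmem => ?_
  rw [Function.update_of_ne (Finset.ne_of_mem_erase hmem)]

/-- Product vectors depend linearly and continuously on each factor. -/
def tmulCLM (v : Fin r → E) (s : Fin r) : E →L[ℝ] H where
  toFun a := τ.tmul (Function.update v s a)
  map_add' a b := by
    -- The defect of additivity is a combination of product vectors. Being orthogonal to every
    -- product vector, it is orthogonal to itself.
    rw [← sub_eq_zero, ← inner_self_eq_zero (𝕜 := ℝ)]
    have h : ∀ w, inner ℝ (τ.tmul (Function.update v s (a + b)) -
        (τ.tmul (Function.update v s a) + τ.tmul (Function.update v s b))) (τ.tmul w) = 0 := by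
      intro w
      simp only [inner_sub_left, inner_add_left, inner_tmul_update]
      ring
    rw [inner_sub_right, inner_add_right, h, h, h]
    simp
  map_smul' c a := by
    rw [← sub_eq_zero, ← inner_self_eq_zero (𝕜 := ℝ)]
    have h : ∀ w, inner ℝ (τ.tmul (Function.update v s (c • a)) -
        c • τ.tmul (Function.update v s a)) (τ.tmul w) = 0 := by
      intro w
      simp only [inner_sub_left, real_inner_smul_left, inner_tmul_update]
      ring
    rw [RingHom.id_apply, inner_sub_right, inner_smul_right, h, h]
    simp
  cont := τ.continuous_tmul.comp (by fun_prop)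

@[simp]
lemma tmulCLM_apply (v : Fin r → E) (s : Fin r) (a : E) :
    τ.tmulCLM v s a = τ.tmul (Function.update v s a) := rfl

/-- Vectors orthogonal to all products of vectors of a total set are orthogonal to all products. -/
lemma inner_tmul_eq_zero [CompleteSpace E] {D : Set E}
    (hD : ∀ e : E, (∀ d ∈ D, inner ℝ e d = 0) → e = 0) {u : H}
    (hu : ∀ v : Fin r → E, (∀ s, v s ∈ D) → inner ℝ u (τ.tmul v) = 0) (v : Fin r → E) :
    inner ℝ u (τ.tmul v) = 0 := by
  have key : ∀ S : Finset (Fin r), ∀ v : Fin r → E, (∀ s ∉ S, v s ∈ D) →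
      inner ℝ u (τ.tmul v) = 0 := by
    intro S
    induction S using Finset.induction_on with
    | empty => exact fun v hv => hu v fun s => hv s (by simp)
    | insert s S hs ih =>
      intro v hv
      -- Factors are freed from D one at a time. With the other factors fixed, the pairing is a
      -- bounded functional of factor s; its Riesz vector is orthogonal to D, hence zero.
      set L : E →L[ℝ] ℝ := (innerSL ℝ u).comp (τ.tmulCLM v s) with hL
      have hw : (InnerProductSpace.toDual ℝ E).symm L = 0 := by
        refine hD _ fun d hd => ?_
        rw [InnerProductSpace.toDual_symm_apply, hL, ContinuousLinearMap.comp_apply,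
          tmulCLM_apply, innerSL_apply_apply]
        refine ih _ fun s' hs' => ?_
        by_cases h : s' = s
        · subst h; simpa using hd
        · rw [Function.update_of_ne h]
          exact hv s' (by simp [h, hs'])
      have h0 : L (v s) = 0 := by
        rw [← InnerProductSpace.toDual_symm_apply, hw, inner_zero_left]
      simpa [hL] using h0
  exact key Finset.univ v (by simp)

end TensorPower

/-! ### The space `H_q` inside the tensor power -/

lemma one_mem_Sobolev (m : ℕ) : (fun _ : ℝ => (1 : ℝ)) ∈ Sobolev m := by
  have h : ∀ k, der k (fun _ : ℝ => (1 : ℝ)) = fun _ => if k = 0 then 1 else 0 := by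
    intro k
    ext x
    simp [der, iteratedDerivWithin_const]
  refine ⟨contDiffOn_const, ?_, ?_⟩
  · rw [h]
    exact ContDiffOn.absolutelyContinuousOnInterval contDiffOn_const
  · rw [h]
    exact memLp_const _

lemma IsElementary.mem_Sobolev {r m q : ℕ} {φ : Fin r → ℝ → ℝ} (h : IsElementary m q φ)
    (s : Fin r) : φ s ∈ Sobolev m := by
  obtain ⟨A, -, h1, h2⟩ := h
  by_cases hs : s ∈ A
  · exact (h1 s hs).1
  · rw [h2 s hs]
    exact one_mem_Sobolev m

section Representation

variable {r m q : ℕ} {E H : Type*} [NormedAddCommGroup E] [InnerProductSpace ℝ E]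
    [NormedAddCommGroup H] [InnerProductSpace ℝ H] (M : SobolevModel m E) (τ : TensorPower r E H)

/-- The vector of a formal sum. -/
def formalVec : FormalSum r →ₗ[ℝ] H :=
  Finsupp.linearCombination ℝ fun φ : Fin r → ℝ → ℝ => τ.tmul fun s => M.emb (φ s)

/-- The formal sums of elementary products. -/
def elementarySums (r m q : ℕ) : Submodule ℝ (FormalSum r) :=
  Finsupp.supported ℝ ℝ {φ : Fin r → ℝ → ℝ | IsElementary m q φ}

/-- The vector that represents the derivative of order `β` at `x`. -/
def derRep (β : Fin r → ℕ) (x : Fin r → ℝ) : H := τ.tmul fun s => M.rep (β s) (x s)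

/-- The closed subspace generated by elementary products. -/
def hqSpace (q : ℕ) : Submodule ℝ H :=
  ((elementarySums r m q).map (formalVec M τ)).topologicalClosure

/-- The vector `u` represents the function `f` of `H_q`. -/
def Represents (q : ℕ) (u : H) (f : (Fin r → ℝ) → ℝ) : Prop :=
  u ∈ hqSpace M τ q ∧ ∀ x ∈ cube r, f x = inner ℝ u (derRep M τ 0 x)

variable {M τ}

lemma form_eq_inner {F G : FormalSum r} (hF : F ∈ elementarySums r m q)
    (hG : G ∈ elementarySums r m q) :
    FormalSum.form m F G = inner ℝ (formalVec M τ F) (formalVec M τ G) := by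
  simp only [formalVec, Finsupp.linearCombination_apply, FormalSum.form, Finsupp.sum, inner_sum,
    sum_inner, real_inner_smul_left, real_inner_smul_right, τ.inner_tmul]
  rw [Finset.sum_comm]
  refine Finset.sum_congr rfl fun γ hγ => Finset.sum_congr rfl fun φ hφ => ?_
  rw [Finset.prod_congr rfl fun s _ => M.inner_emb _ (IsElementary.mem_Sobolev (hF hφ) s) _
    (IsElementary.mem_Sobolev (hG hγ) s)]
  ring

lemma eval_eq_inner {F : FormalSum r} (hF : F ∈ elementarySums r m q) {x : Fin r → ℝ}
    (hx : x ∈ cube r) : F.eval x = inner ℝ (formalVec M τ F) (derRep M τ 0 x) := by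
  simp only [formalVec, Finsupp.linearCombination_apply, FormalSum.eval, Finsupp.sum, sum_inner,
    real_inner_smul_left, derRep, τ.inner_tmul, Pi.zero_apply]
  refine Finset.sum_congr rfl fun φ hφ => ?_
  rw [Finset.prod_congr rfl fun s _ => M.inner_emb_rep _ (IsElementary.mem_Sobolev (hF hφ) s) _
    (hx s (Set.mem_univ s))]

lemma Approximates.mem {F : ℕ → FormalSum r} {f : (Fin r → ℝ) → ℝ} (h : Approximates m q F f)
    (k : ℕ) : F k ∈ elementarySums r m q := fun φ hφ => h.elementary k φ hφ

lemma inner_eq_zero_of_forall_derRep [CompleteSpace E] {u : H}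
    (hu : ∀ x ∈ cube r, inner ℝ u (derRep M τ 0 x) = 0) (v : Fin r → E) :
    inner ℝ u (τ.tmul v) = 0 := by
  refine τ.inner_tmul_eq_zero (D := M.rep 0 '' Set.Icc 0 1) ?_ ?_ v
  · exact fun e he => M.total e fun t ht => he _ ⟨t, ht, rfl⟩
  · intro v hv
    choose x hx hxv using hv
    rw [show v = fun s => M.rep 0 (x s) from funext fun s => (hxv s).symm]
    exact hu x fun s _ => hx s

/-- By totality of the evaluation vectors in each factor, u is orthogonal to all products, hence to
the closed subspace that they generate and that contains u itself. -/
lemma eq_zero_of_forall_derRep [CompleteSpace E] {u : H} (hmem : u ∈ hqSpace M τ q)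
    (hu : ∀ x ∈ cube r, inner ℝ u (derRep M τ 0 x) = 0) : u = 0 := by
  have h : hqSpace M τ q ≤ (ℝ ∙ u)ᗮ := by
    refine Submodule.topologicalClosure_minimal _ ?_ (Submodule.isClosed_orthogonal _)
    rintro _ ⟨F, -, rfl⟩
    rw [Submodule.mem_orthogonal_singleton_iff_inner_right, formalVec,
      Finsupp.linearCombination_apply, Finsupp.sum, inner_sum]
    refine Finset.sum_eq_zero fun φ _ => ?_
    rw [inner_smul_right, inner_eq_zero_of_forall_derRep hu, mul_zero]
  simpa using Submodule.mem_orthogonal_singleton_iff_inner_right.1 (h hmem)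

lemma Represents.unique [CompleteSpace E] {u v : H} {f : (Fin r → ℝ) → ℝ}
    (hu : Represents M τ q u f) (hv : Represents M τ q v f) : u = v := by
  rw [← sub_eq_zero]
  refine eq_zero_of_forall_derRep (Submodule.sub_mem _ hu.1 hv.1) fun x hx => ?_
  rw [inner_sub_left, ← hu.2 x hx, ← hv.2 x hx, sub_self]

/-- The form on formal sums is the inner product of their vectors, so a Cauchy sequence of sums
converges in H, and pointwise values pass to the limit as inner products. With
`Represents.exists_approximates` this identifies H_q with the functions represented in `hqSpace`. -/
lemma Approximates.exists_represents [CompleteSpace H] {F : ℕ → FormalSum r}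
    {f : (Fin r → ℝ) → ℝ} (h : Approximates m q F f) :
    ∃ u, Represents M τ q u f ∧ Tendsto (fun k => formalVec M τ (F k)) atTop (𝓝 u) := by
  have hc : CauchySeq fun k => formalVec M τ (F k) := by
    refine Metric.cauchySeq_iff.2 fun η hη => ?_
    obtain ⟨N, hN⟩ := h.cauchy (η ^ 2) (by positivity)
    refine ⟨N, fun k hk l hl => ?_⟩
    have := hN k hk l hl
    have hmem := Submodule.sub_mem _ (h.mem k) (h.mem l)
    rw [form_eq_inner (M := M) (τ := τ) hmem hmem, map_sub, real_inner_self_eq_norm_sq] at this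
    rw [dist_eq_norm]
    exact lt_of_pow_lt_pow_left₀ 2 hη.le this
  obtain ⟨u, hu⟩ := cauchySeq_tendsto_of_complete hc
  refine ⟨u, ⟨?_, fun x hx => ?_⟩, hu⟩
  · exact mem_closure_of_tendsto hu (Eventually.of_forall fun k => ⟨F k, h.mem k, rfl⟩)
  · refine tendsto_nhds_unique (h.tendsto x hx) ?_
    have := hu.inner (tendsto_const_nhds (x := derRep M τ 0 x)) (𝕜 := ℝ)
    exact this.congr fun k => (eval_eq_inner (h.mem k) hx).symm

lemma Represents.exists_approximates {u : H} {f : (Fin r → ℝ) → ℝ} (h : Represents M τ q u f) :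
    ∃ F, Approximates m q F f ∧ Tendsto (fun k => formalVec M τ (F k)) atTop (𝓝 u) := by
  obtain ⟨v, hv, hvu⟩ := mem_closure_iff_seq_limit.1 h.1
  choose F hF hFv using hv
  have hlim : Tendsto (fun k => formalVec M τ (F k)) atTop (𝓝 u) := by simpa only [hFv] using hvu
  refine ⟨F, ⟨fun k φ hφ => hF k hφ, fun η hη => ?_, fun x hx => ?_⟩, hlim⟩
  · obtain ⟨N, hN⟩ := Metric.cauchySeq_iff.1 hlim.cauchySeq (√η) (Real.sqrt_pos.2 hη)
    refine ⟨N, fun k hk l hl => ?_⟩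
    have hmem := Submodule.sub_mem _ (hF k) (hF l)
    rw [form_eq_inner (M := M) (τ := τ) hmem hmem, map_sub, real_inner_self_eq_norm_sq,
      ← Real.sqrt_lt_sqrt_iff (by positivity), Real.sqrt_sq (norm_nonneg _), ← dist_eq_norm]
    exact hN k hk l hl
  · rw [h.2 x hx]
    have := hlim.inner (tendsto_const_nhds (x := derRep M τ 0 x)) (𝕜 := ℝ)
    exact this.congr fun k => (eval_eq_inner (hF k) hx).symm

lemma exists_represents [CompleteSpace H] {f : (Fin r → ℝ) → ℝ} (hf : f ∈ Hq r m q) :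
    ∃ u, Represents M τ q u f := by
  obtain ⟨F, hF⟩ := hf
  obtain ⟨u, hu, -⟩ := hF.exists_represents (M := M) (τ := τ)
  exact ⟨u, hu⟩

lemma Represents.mem_Hq {u : H} {f : (Fin r → ℝ) → ℝ} (h : Represents M τ q u f) :
    f ∈ Hq r m q := by
  obtain ⟨F, hF, -⟩ := h.exists_approximates
  exact ⟨F, hF⟩

/-- The choice made by `Classical.epsilon` is harmless: all approximating sequences of f have the
same limit, because the representing vector is unique. -/
lemma innerHq_eq_inner [CompleteSpace E] [CompleteSpace H] {u v : H} {f g : (Fin r → ℝ) → ℝ}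
    (hu : Represents M τ q u f) (hv : Represents M τ q v g) : innerHq m q f g = inner ℝ u v := by
  obtain ⟨F, hF, hFu⟩ := hu.exists_approximates
  obtain ⟨G, hG, hGv⟩ := hv.exists_approximates
  have hex : HasInner m q f g (inner ℝ u v) := by
    refine ⟨F, G, hF, hG, ?_⟩
    exact (hFu.inner hGv (𝕜 := ℝ)).congr fun k => (form_eq_inner (hF.mem k) (hG.mem k)).symm
  obtain ⟨F', G', hF', hG', hlim⟩ : HasInner m q f g (innerHq m q f g) :=
    Classical.epsilon_spec (p := HasInner m q f g) ⟨_, hex⟩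
  obtain ⟨u', hu', hFu'⟩ := hF'.exists_represents (M := M) (τ := τ)
  obtain ⟨v', hv', hGv'⟩ := hG'.exists_represents (M := M) (τ := τ)
  rw [hu'.unique hu] at hFu'
  rw [hv'.unique hv] at hGv'
  refine tendsto_nhds_unique hlim ?_
  exact (hFu'.inner hGv' (𝕜 := ℝ)).congr fun k => (form_eq_inner (hF'.mem k) (hG'.mem k)).symm

lemma Represents.sub {u v : H} {f g : (Fin r → ℝ) → ℝ} (hu : Represents M τ q u f)
    (hv : Represents M τ q v g) : Represents M τ q (u - v) (fun x => f x - g x) :=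
  ⟨Submodule.sub_mem _ hu.1 hv.1, fun x hx => by
    rw [inner_sub_left, ← hu.2 x hx, ← hv.2 x hx]⟩

lemma continuous_derRep {β : Fin r → ℕ} (hβ : ∀ s, β s ≤ m - 1) : Continuous (derRep M τ β) :=
  τ.continuous_tmul.comp (continuous_pi fun s =>
    (M.continuous_rep _ (hβ s)).comp (continuous_apply s))

lemma Represents.continuousOn {u : H} {f : (Fin r → ℝ) → ℝ} (h : Represents M τ q u f) :
    ContinuousOn f (cube r) := by
  have hc : Continuous fun x => inner ℝ u (derRep M τ 0 x) :=
    continuous_const.inner (continuous_derRep (by simp))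
  exact hc.continuousOn.congr h.2

lemma hasDerivAt_derRep {β : Fin r → ℕ} {s : Fin r} (hs : β s + 1 ≤ m - 1) (x : Fin r → ℝ)
    (t : ℝ) : HasDerivAt (fun t => derRep M τ β (Function.update x s t))
      (derRep M τ (Function.update β s (β s + 1)) (Function.update x s t)) t := by
  have h := (τ.tmulCLM (fun s => M.rep (β s) (x s)) s).hasFDerivAt.comp_hasDerivAt t
    (M.hasDerivAt_rep (β s) hs t)
  convert h using 1
  · ext t
    simp only [derRep, Function.comp_apply, TensorPower.tmulCLM_apply]
    congr 1
    ext s'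
    by_cases h : s' = s
    · subst h; simp
    · simp [h]
  · simp only [derRep, TensorPower.tmulCLM_apply]
    congr 1
    ext s'
    by_cases h : s' = s
    · subst h; simp
    · simp [h]

lemma iteratedDerivWithin_inner_derRep (u : H) {β : Fin r → ℕ} {s : Fin r} {k : ℕ}
    (hs : β s + k ≤ m - 1) (x : Fin r → ℝ) {t : ℝ} (ht : t ∈ Set.Icc (0 : ℝ) 1) :
    iteratedDerivWithin k (fun t => inner ℝ u (derRep M τ β (Function.update x s t)))
      (Set.Icc 0 1) t =
      inner ℝ u (derRep M τ (Function.update β s (β s + k)) (Function.update x s t)) := by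
  induction k generalizing t with
  | zero => simp
  | succ k ih =>
    rw [iteratedDerivWithin_succ, derivWithin_congr (fun t ht => ih (by omega) ht) (ih (by omega) ht)]
    have h := hasDerivAt_derRep (M := M) (τ := τ) (β := Function.update β s (β s + k)) (s := s)
      (by simpa using (show β s + k < m - 1 by omega)) x t
    have h' : HasDerivAt (fun t => inner ℝ u
        (derRep M τ (Function.update β s (β s + k)) (Function.update x s t))) _ t :=
      (hasDerivAt_const t u).inner ℝ h
    rw [h'.hasDerivWithinAt.derivWithin (uniqueDiffOn_unitInterval t ht)]
    simp [add_assoc]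

lemma update_mem_cube {x : Fin r → ℝ} (hx : x ∈ cube r) (s : Fin r) {t : ℝ}
    (ht : t ∈ Set.Icc (0 : ℝ) 1) : Function.update x s t ∈ cube r := by
  intro s' _
  by_cases h : s' = s
  · subst h; simpa using ht
  · simpa [h] using hx s' (Set.mem_univ s')

lemma Represents.mixedDer_eq {u : H} {f : (Fin r → ℝ) → ℝ} (h : Represents M τ q u f)
    {β : Fin r → ℕ} (hβ : ∀ s, β s ≤ m - 1) {x : Fin r → ℝ} (hx : x ∈ cube r) :
    mixedDer β f x = inner ℝ u (derRep M τ β x) := by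
  -- The fold is generalized to lists without repetition, so that no derivative in x_s has been
  -- taken yet when s is reached.
  have key : ∀ l : List (Fin r), l.Nodup → ∀ x ∈ cube r,
      l.foldr (fun s g => partialDer s (β s) g) f x =
        inner ℝ u (derRep M τ (fun s => if s ∈ l then β s else 0) x) := by
    intro l
    induction l with
    | nil =>
      intro _ x hx
      simp only [List.foldr_nil, List.not_mem_nil, if_false]
      exact h.2 x hx
    | cons s l ih =>
      intro hl x hx
      obtain ⟨hsl, hl⟩ := List.nodup_cons.1 hl
      have hxs := hx s (Set.mem_univ s)
      rw [List.foldr_cons, partialDer, iteratedDerivWithin_congr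
        (fun t ht => ih hl (Function.update x s t) (update_mem_cube hx s ht)) hxs,
        iteratedDerivWithin_inner_derRep u (by simpa [hsl] using hβ s) x hxs,
        Function.update_eq_self]
      congr 2
      ext s'
      by_cases h' : s' = s
      · subst h'; simp [hsl]
      · simp [h']
  have := key (List.finRange r) (List.nodup_finRange r) x hx
  simp only [List.mem_finRange, if_true] at this
  exact this

end Representation

/-! ### Eigenfunction expansions in `H_q` -/

lemma cube_eq_Icc (r : ℕ) : cube r = Set.Icc 0 1 := by
  rw [cube, Set.pi_univ_Icc]
  rfl

lemma isCompact_cube (r : ℕ) : IsCompact (cube r) := by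
  rw [cube_eq_Icc]
  exact isCompact_Icc

lemma measurableSet_cube (r : ℕ) : MeasurableSet (cube r) := by
  rw [cube_eq_Icc]
  exact measurableSet_Icc

lemma cube_subset_closure_interior (r : ℕ) : cube r ⊆ closure (interior (cube r)) := by
  rw [cube, interior_pi_set Set.finite_univ, closure_pi_set]
  simp

lemma innerL2_comm {r : ℕ} (π f g : (Fin r → ℝ) → ℝ) : innerL2 π f g = innerL2 π g f := by
  simp only [innerL2, mul_comm (f _)]

lemma integrableOn_cube_mul {r : ℕ} {π f g : (Fin r → ℝ) → ℝ} {Cπ : ℝ} (hπ : Measurable π)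
    (hπb : ∀ x ∈ cube r, Cπ⁻¹ ≤ π x ∧ π x ≤ Cπ) (hCπ : 1 ≤ Cπ) (hf : ContinuousOn f (cube r))
    (hg : ContinuousOn g (cube r)) : IntegrableOn (fun x => f x * g x * π x) (cube r) := by
  refine Integrable.mul_bdd ((hf.mul hg).integrableOn_compact (isCompact_cube r)) (c := Cπ)
    hπ.aestronglyMeasurable ?_
  filter_upwards [ae_restrict_mem (measurableSet_cube r)] with x hx
  have : 0 ≤ Cπ⁻¹ := by positivity
  rw [Real.norm_of_nonneg (this.trans (hπb x hx).1)]
  exact (hπb x hx).2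

/-- The density is positive, so f vanishes almost everywhere on the cube; continuity extends this to
every point, as the cube lies in the closure of its interior. -/
lemma eq_zero_of_innerL2_self {r : ℕ} {π f : (Fin r → ℝ) → ℝ} {Cπ : ℝ} (hπ : Measurable π)
    (hπb : ∀ x ∈ cube r, Cπ⁻¹ ≤ π x ∧ π x ≤ Cπ) (hCπ : 1 ≤ Cπ) (hf : ContinuousOn f (cube r))
    (h : innerL2 π f f = 0) : ∀ x ∈ cube r, f x = 0 := by
  have hpos : ∀ x ∈ cube r, 0 < π x := fun x hx =>
    lt_of_lt_of_le (inv_pos.2 (by linarith)) (hπb x hx).1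
  have hae : (fun x => f x * f x * π x) =ᵐ[volume.restrict (cube r)] 0 := by
    refine (integral_eq_zero_iff_of_nonneg_ae ?_
      (integrableOn_cube_mul hπ hπb hCπ hf hf)).1 h
    filter_upwards [ae_restrict_mem (measurableSet_cube r)] with x hx
    exact mul_nonneg (mul_self_nonneg _) (hpos x hx).le
  have hae' : f =ᵐ[volume.restrict (cube r)] 0 := by
    filter_upwards [hae, ae_restrict_mem (measurableSet_cube r)] with x hx hxc
    simpa [(hpos x hxc).ne'] using hx
  exact Measure.eqOn_of_ae_eq hae' hf continuousOn_const (cube_subset_closure_interior r)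

section Expansion

variable {r m q : ℕ} {E H : Type*} [NormedAddCommGroup E] [InnerProductSpace ℝ E] [CompleteSpace E]
    [NormedAddCommGroup H] [InnerProductSpace ℝ H] [CompleteSpace H]
    {M : SobolevModel m E} {τ : TensorPower r E H}
    {π : (Fin r → ℝ) → ℝ} {Cπ : ℝ} {ρ : MultiIdx r q → ℝ} {ψ : MultiIdx r q → (Fin r → ℝ) → ℝ}

/-- The vectors √ρ_i u_i are a Hilbert basis of `hqSpace`, and the eigenvalue relation turns H_q
coefficients into L_2 coefficients. The two sums are the expansion of w and Parseval's identity in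
this basis. -/
lemma IsEigensystem.hasSum_represents (hψ : IsEigensystem m q π ρ ψ) (hπ : Measurable π)
    (hπb : ∀ x ∈ cube r, Cπ⁻¹ ≤ π x ∧ π x ≤ Cπ) (hCπ : 1 ≤ Cπ)
    {u : MultiIdx r q → H} (hu : ∀ i, Represents M τ q (u i) (ψ i))
    {f : (Fin r → ℝ) → ℝ} {w : H} (hw : Represents M τ q w f) :
    HasSum (fun i => innerL2 π f (ψ i) • u i) w ∧
      HasSum (fun i => innerL2 π f (ψ i) ^ 2 / ρ i) (inner ℝ w w) := by
  have hclosed : IsClosed (hqSpace M τ q : Set H) := Submodule.isClosed_topologicalClosure _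
  have : CompleteSpace (hqSpace M τ q) := hclosed.completeSpace_coe
  have hcoef : ∀ i, ∀ {g : (Fin r → ℝ) → ℝ} {v : H}, Represents M τ q v g →
      inner ℝ (u i) v = innerL2 π g (ψ i) / ρ i := by
    intro i g v hv
    rw [innerL2_comm, hψ.eigen i g hv.mem_Hq, innerHq_eq_inner (hu i) hv,
      mul_div_cancel_left₀ _ (hψ.pos i).ne']
  set e : MultiIdx r q → hqSpace M τ q := fun i => ⟨√(ρ i) • u i, Submodule.smul_mem _ _ (hu i).1⟩
    with he
  have hsq : ∀ i, √(ρ i) * √(ρ i) = ρ i := fun i => Real.mul_self_sqrt (hψ.pos i).le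
  have horth : Orthonormal ℝ e := by
    classical
    rw [orthonormal_iff_ite]
    intro i j
    rw [Submodule.coe_inner]
    simp only [he, real_inner_smul_left, real_inner_smul_right]
    rw [← innerHq_eq_inner (hu i) (hu j), hψ.orthoHq]
    split_ifs with hij
    · subst hij
      rw [← mul_assoc, hsq, mul_one_div_cancel (hψ.pos i).ne']
    · simp
  -- Completeness is transferred from L_2: a vector orthogonal to the system has zero L_2
  -- coefficients, hence zero L_2 norm, hence it represents the zero function.
  have hbot : (Submodule.span ℝ (Set.range e))ᗮ = ⊥ := by
    refine (Submodule.eq_bot_iff _).2 fun v hv => ?_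
    have hrep : Represents M τ q (v : H) (fun x => inner ℝ (v : H) (derRep M τ 0 x)) :=
      ⟨v.2, fun _ _ => rfl⟩
    have hzero : ∀ i, innerL2 π (fun x => inner ℝ (v : H) (derRep M τ 0 x)) (ψ i) = 0 := by
      intro i
      have h1 := (Submodule.mem_orthogonal _ _).1 hv (e i)
        (Submodule.subset_span (Set.mem_range_self i))
      rw [Submodule.coe_inner] at h1
      simp only [he, real_inner_smul_left, hcoef i hrep] at h1
      have h2 : √(ρ i) ≠ 0 := (Real.sqrt_pos.2 (hψ.pos i)).ne'
      simpa [h2, (hψ.pos i).ne'] using h1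
    have hnorm := hψ.basis _ hrep.mem_Hq
    simp only [hzero] at hnorm
    have h0 : innerL2 π (fun x => inner ℝ (v : H) (derRep M τ 0 x))
        (fun x => inner ℝ (v : H) (derRep M τ 0 x)) = 0 :=
      hnorm.unique (by simp)
    exact Subtype.ext (eq_zero_of_forall_derRep v.2
      (eq_zero_of_innerL2_self hπ hπb hCπ hrep.continuousOn h0))
  set b := HilbertBasis.mkOfOrthogonalEqBot horth hbot with hb
  have hbe : ∀ i, b i = e i := fun i => by rw [hb, HilbertBasis.coe_mkOfOrthogonalEqBot]
  have hbw : ∀ i, inner ℝ (b i) (⟨w, hw.1⟩ : hqSpace M τ q) = √(ρ i) * (innerL2 π f (ψ i) / ρ i) := by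
    intro i
    rw [hbe, Submodule.coe_inner]
    simp only [he, real_inner_smul_left, hcoef i hw]
  constructor
  · have h := (b.hasSum_repr ⟨w, hw.1⟩).mapL (hqSpace M τ q).subtypeL
    refine h.congr_fun fun i => ?_
    rw [b.repr_apply_apply, hbw, hbe]
    simp only [he, map_smul, Submodule.subtypeL_apply, smul_smul]
    congr 1
    rw [mul_right_comm, hsq, mul_div_cancel₀ _ (hψ.pos i).ne']
  · have h := b.hasSum_inner_mul_inner ⟨w, hw.1⟩ ⟨w, hw.1⟩
    rw [Submodule.coe_inner] at h
    refine h.congr_fun fun i => ?_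
    rw [real_inner_comm, hbw]
    have := (hψ.pos i).ne'
    field_simp
    rw [Real.sq_sqrt (hψ.pos i).le]

end Expansion

/-! ### Properties of H_q stated for functions only -/

section Interface

variable {r m q : ℕ} {π : (Fin r → ℝ) → ℝ} {Cπ : ℝ} {ρ : MultiIdx r q → ℝ}
    {ψ : MultiIdx r q → (Fin r → ℝ) → ℝ} {f g : (Fin r → ℝ) → ℝ}

/-- A Hilbert space realization of `H_q` exists. -/
lemma exists_realization (r : ℕ) {m : ℕ} (hm : 1 ≤ m) :
    ∃ (H : Type) (_ : NormedAddCommGroup H) (_ : InnerProductSpace ℝ H) (_ : CompleteSpace H)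
      (τ : TensorPower r (JetSpace m) H), ∀ q, ∀ f ∈ Hq r m q,
        ∃ u, Represents (jetModel hm) τ q u f := by
  obtain ⟨H, h1, h2, h3, ⟨τ⟩⟩ := exists_tensorPower r (JetSpace m)
  exact ⟨H, h1, h2, h3, τ, fun q f hf => exists_represents hf⟩

lemma IsEigensystem.hasSum_sq_div (hψ : IsEigensystem m q π ρ ψ) (hm : 1 ≤ m) (hπ : Measurable π)
    (hπb : ∀ x ∈ cube r, Cπ⁻¹ ≤ π x ∧ π x ≤ Cπ) (hCπ : 1 ≤ Cπ) (hf : f ∈ Hq r m q) :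
    HasSum (fun i => innerL2 π f (ψ i) ^ 2 / ρ i) (innerHq m q f f) := by
  obtain ⟨H, _, _, _, τ, hτ⟩ := exists_realization r hm
  choose u hu using fun i => hτ q (ψ i) (hψ.mem i)
  obtain ⟨w, hw⟩ := hτ q f hf
  rw [innerHq_eq_inner hw hw]
  exact (hψ.hasSum_represents hπ hπb hCπ hu hw).2

/-- The derivative at x is a bounded functional on the realization, so the norm-convergent expansion
may be differentiated term by term. -/
lemma IsEigensystem.hasSum_mixedDer (hψ : IsEigensystem m q π ρ ψ) (hm : 1 ≤ m)
    (hπ : Measurable π) (hπb : ∀ x ∈ cube r, Cπ⁻¹ ≤ π x ∧ π x ≤ Cπ) (hCπ : 1 ≤ Cπ)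
    (hf : f ∈ Hq r m q) {β : Fin r → ℕ} (hβ : ∀ s, β s ≤ m - 1) {x : Fin r → ℝ}
    (hx : x ∈ cube r) :
    HasSum (fun i => innerL2 π f (ψ i) * mixedDer β (ψ i) x) (mixedDer β f x) := by
  obtain ⟨H, _, _, _, τ, hτ⟩ := exists_realization r hm
  choose u hu using fun i => hτ q (ψ i) (hψ.mem i)
  obtain ⟨w, hw⟩ := hτ q f hf
  have h := (hψ.hasSum_represents hπ hπb hCπ hu hw).1.mapL
    (innerSL ℝ (derRep (jetModel hm) τ β x))
  rw [hw.mixedDer_eq hβ hx, real_inner_comm]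
  refine h.congr_fun fun i => ?_
  rw [(hu i).mixedDer_eq hβ hx, real_inner_comm]
  simp

lemma mixedDer_zero (f : (Fin r → ℝ) → ℝ) : mixedDer 0 f = f := by
  have h : ∀ l : List (Fin r), l.foldr (fun s g => partialDer s 0 g) f = f := by
    intro l
    induction l with
    | nil => rfl
    | cons s l ih =>
      rw [List.foldr_cons, ih]
      ext x
      simp [partialDer]
  exact h _

lemma IsEigensystem.hasSum_apply (hψ : IsEigensystem m q π ρ ψ) (hm : 1 ≤ m)
    (hπ : Measurable π) (hπb : ∀ x ∈ cube r, Cπ⁻¹ ≤ π x ∧ π x ≤ Cπ) (hCπ : 1 ≤ Cπ)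
    (hf : f ∈ Hq r m q) {x : Fin r → ℝ} (hx : x ∈ cube r) :
    HasSum (fun i => innerL2 π f (ψ i) * ψ i x) (f x) := by
  simpa only [mixedDer_zero] using
    hψ.hasSum_mixedDer hm hπ hπb hCπ hf (β := 0) (by simp) hx

lemma sub_mem_Hq (hm : 1 ≤ m) (hf : f ∈ Hq r m q) (hg : g ∈ Hq r m q) :
    (fun x => f x - g x) ∈ Hq r m q := by
  obtain ⟨H, _, _, _, τ, hτ⟩ := exists_realization r hm
  obtain ⟨u, hu⟩ := hτ q f hf
  obtain ⟨v, hv⟩ := hτ q g hg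
  exact (hu.sub hv).mem_Hq

lemma mixedDer_sub (hm : 1 ≤ m) (hf : f ∈ Hq r m q) (hg : g ∈ Hq r m q) {β : Fin r → ℕ}
    (hβ : ∀ s, β s ≤ m - 1) {x : Fin r → ℝ} (hx : x ∈ cube r) :
    mixedDer β (fun x => f x - g x) x = mixedDer β f x - mixedDer β g x := by
  obtain ⟨H, _, _, _, τ, hτ⟩ := exists_realization r hm
  obtain ⟨u, hu⟩ := hτ q f hf
  obtain ⟨v, hv⟩ := hτ q g hg
  rw [(hu.sub hv).mixedDer_eq hβ hx, hu.mixedDer_eq hβ hx, hv.mixedDer_eq hβ hx, inner_sub_left]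

lemma continuousOn_of_mem_Hq (hm : 1 ≤ m) (hf : f ∈ Hq r m q) : ContinuousOn f (cube r) := by
  obtain ⟨H, _, _, _, τ, hτ⟩ := exists_realization r hm
  obtain ⟨u, hu⟩ := hτ q f hf
  exact hu.continuousOn

lemma innerHq_self_nonneg (hm : 1 ≤ m) (hf : f ∈ Hq r m q) : 0 ≤ innerHq m q f f := by
  obtain ⟨H, _, _, _, τ, hτ⟩ := exists_realization r hm
  obtain ⟨u, hu⟩ := hτ q f hf
  rw [innerHq_eq_inner hu hu]
  exact real_inner_self_nonneg

/-- A lower bound for the penalty at `f` in terms of the distance to `g`. -/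
lemma innerHq_sub_ge (hm : 1 ≤ m) (hf : f ∈ Hq r m q) (hg : g ∈ Hq r m q) :
    innerHq m q (fun x => f x - g x) (fun x => f x - g x) -
      2 * √(innerHq m q g g) * √(innerHq m q (fun x => f x - g x) (fun x => f x - g x)) ≤
      innerHq m q f f - innerHq m q g g := by
  obtain ⟨H, _, _, _, τ, hτ⟩ := exists_realization r hm
  obtain ⟨u, hu⟩ := hτ q f hf
  obtain ⟨v, hv⟩ := hτ q g hg
  rw [innerHq_eq_inner hu hu, innerHq_eq_inner hv hv, innerHq_eq_inner (hu.sub hv) (hu.sub hv)]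
  simp only [real_inner_self_eq_norm_sq, Real.sqrt_sq (norm_nonneg _)]
  have h1 : ‖u‖ ^ 2 = ‖u - v‖ ^ 2 + 2 * inner ℝ (u - v) v + ‖v‖ ^ 2 := by
    rw [← norm_add_sq_real, sub_add_cancel]
  have h2 := neg_le_of_abs_le (abs_real_inner_le_norm (u - v) v)
  nlinarith

end Interface

section

/-! ### The deterministic part of the error bound -/

/-- The Cauchy-Schwarz inequality for weighted sums. -/
lemma sq_le_mul_of_hasSum {ι : Type*} {a b w : ι → ℝ} {s A B : ℝ} (hw : ∀ i, 0 < w i)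
    (hs : HasSum (fun i => a i * b i) s) (hA : HasSum (fun i => a i ^ 2 / w i) A)
    (hB : ∑' i, ENNReal.ofReal (w i * b i ^ 2) ≤ ENNReal.ofReal B) (hB0 : 0 ≤ B) :
    s ^ 2 ≤ A * B := by
  refine le_of_tendsto' (hs.pow 2) fun F => ?_
  have h1 : ∑ i ∈ F, a i ^ 2 / w i ≤ A :=
    sum_le_hasSum F (fun i _ => div_nonneg (sq_nonneg _) (hw i).le) hA
  have h2 : ∑ i ∈ F, w i * b i ^ 2 ≤ B := by
    have hnn : ∀ i ∈ F, 0 ≤ w i * b i ^ 2 := fun i _ => mul_nonneg (hw i).le (sq_nonneg _)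
    rw [← ENNReal.ofReal_le_ofReal_iff hB0, ENNReal.ofReal_sum_of_nonneg hnn]
    exact (ENNReal.sum_le_tsum F).trans hB
  have h0 : 0 ≤ ∑ i ∈ F, a i ^ 2 / w i :=
    Finset.sum_nonneg fun i _ => div_nonneg (sq_nonneg _) (hw i).le
  calc (∑ i ∈ F, a i * b i) ^ 2
      ≤ (∑ i ∈ F, a i ^ 2 / w i) * ∑ i ∈ F, w i * b i ^ 2 := by
        refine Finset.sum_sq_le_sum_mul_sum_of_sq_le_mul F
          (fun i _ => div_nonneg (sq_nonneg _) (hw i).le)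
          (fun i _ => mul_nonneg (hw i).le (sq_nonneg _)) fun i _ => ?_
        have := (hw i).ne'
        refine le_of_eq ?_
        field_simp
    _ ≤ A * B := mul_le_mul h1 h2
        (Finset.sum_nonneg fun i _ => mul_nonneg (hw i).le (sq_nonneg _)) (h0.trans h1)

lemma HasSum.mul_prod {ι : Type*} {a b : ι → ℝ} {s t : ℝ} (ha : HasSum a s) (hb : HasSum b t) :
    HasSum (fun p : ι × ι => a p.1 * b p.2) (s * t) :=
  ha.mul hb (summable_mul_of_summable_norm ha.summable.norm hb.summable.norm)

/-- The weights `1 / (1 + λ / ρ_i)`. -/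
def shrink {ι : Type*} (ρ : ι → ℝ) (lam : ℝ) (i : ι) : ℝ := 1 / (1 + lam / ρ i)

lemma shrink_pos {ι : Type*} {ρ : ι → ℝ} (hρ : ∀ i, 0 < ρ i) {lam : ℝ} (hlam : 0 < lam) (i : ι) :
    0 < shrink ρ lam i := by
  have := hρ i
  rw [shrink]
  positivity

/-- The squared norm `‖f‖²_{L_2} + λ ‖f‖²_{H_q}`. -/
def penNormSq {r : ℕ} (m q : ℕ) (π : (Fin r → ℝ) → ℝ) (lam : ℝ) (f : (Fin r → ℝ) → ℝ) : ℝ :=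
  innerL2 π f f + lam * innerHq m q f f

variable {r m q : ℕ} {π : (Fin r → ℝ) → ℝ} {Cπ : ℝ} {ρ : MultiIdx r q → ℝ}
    {ψ : MultiIdx r q → (Fin r → ℝ) → ℝ} {f f₀ fhat : (Fin r → ℝ) → ℝ} {lam : ℝ}

lemma IsEigensystem.hasSum_penNormSq (hψ : IsEigensystem m q π ρ ψ) (hm : 1 ≤ m)
    (hπ : Measurable π) (hπb : ∀ x ∈ cube r, Cπ⁻¹ ≤ π x ∧ π x ≤ Cπ) (hCπ : 1 ≤ Cπ)
    (hf : f ∈ Hq r m q) :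
    HasSum (fun i => innerL2 π f (ψ i) ^ 2 / shrink ρ lam i) (penNormSq m q π lam f) := by
  refine ((hψ.basis f hf).add ((hψ.hasSum_sq_div hm hπ hπb hCπ hf).mul_left lam)).congr_fun
    fun i => ?_
  rw [shrink, div_div_eq_mul_div, div_one]
  ring

/-- The empirical version of `⟨f, g⟩_{L_2}`. -/
def empInner {r n : ℕ} (x : Fin n → Fin r → ℝ) (f g : (Fin r → ℝ) → ℝ) : ℝ :=
  (n : ℝ)⁻¹ * ∑ k, f (x k) * g (x k)

/-- The empirical correlation of noise and a function. -/
def empNoise {r n : ℕ} (x : Fin n → Fin r → ℝ) (ε : Fin n → ℝ) (f : (Fin r → ℝ) → ℝ) : ℝ :=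
  (n : ℝ)⁻¹ * ∑ k, ε k * f (x k)

/-- The sum in `hN` is the squared dual norm of the noise functional with respect to `penNormSq`. -/
lemma IsEigensystem.empNoise_sq_le {n : ℕ} (hψ : IsEigensystem m q π ρ ψ) (hm : 1 ≤ m)
    (hπ : Measurable π) (hπb : ∀ x ∈ cube r, Cπ⁻¹ ≤ π x ∧ π x ≤ Cπ) (hCπ : 1 ≤ Cπ)
    (hlam : 0 < lam) (hf : f ∈ Hq r m q) {x : Fin n → Fin r → ℝ} (hx : ∀ k, x k ∈ cube r)
    {ε : Fin n → ℝ} {N : ℝ} (hN0 : 0 ≤ N)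
    (hN : ∑' j, ENNReal.ofReal (shrink ρ lam j * empNoise x ε (ψ j) ^ 2) ≤ ENNReal.ofReal N) :
    empNoise x ε f ^ 2 ≤ penNormSq m q π lam f * N := by
  refine sq_le_mul_of_hasSum (shrink_pos hψ.pos hlam) ?_
    (hψ.hasSum_penNormSq hm hπ hπb hCπ hf) hN hN0
  refine ((hasSum_sum fun k _ => (hψ.hasSum_apply hm hπ hπb hCπ hf (hx k)).mul_left (ε k)).mul_left
    (n : ℝ)⁻¹).congr_fun fun j => ?_
  simp only [empNoise, Finset.mul_sum]
  exact Finset.sum_congr rfl fun k _ => by ring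

/-- The quadratic form expands as a double series in the products of coefficients of f, whose
weighted square sum is the square of `penNormSq`. Orthonormality places the population part on the
diagonal. -/
lemma IsEigensystem.empInner_sub_sq_le {n : ℕ} (hψ : IsEigensystem m q π ρ ψ) (hm : 1 ≤ m)
    (hπ : Measurable π) (hπb : ∀ x ∈ cube r, Cπ⁻¹ ≤ π x ∧ π x ≤ Cπ) (hCπ : 1 ≤ Cπ)
    (hlam : 0 < lam) (hf : f ∈ Hq r m q) {x : Fin n → Fin r → ℝ} (hx : ∀ k, x k ∈ cube r)
    {K : ℝ} (hK0 : 0 ≤ K)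
    (hK : ∑' p : MultiIdx r q × MultiIdx r q, ENNReal.ofReal (shrink ρ lam p.1 * shrink ρ lam p.2 *
      (empInner x (ψ p.1) (ψ p.2) - innerL2 π (ψ p.1) (ψ p.2)) ^ 2) ≤ ENNReal.ofReal K) :
    (empInner x f f - innerL2 π f f) ^ 2 ≤ penNormSq m q π lam f ^ 2 * K := by
  have hsum := hψ.hasSum_penNormSq hm hπ hπb hCπ hf (lam := lam)
  rw [sq (penNormSq m q π lam f)]
  refine sq_le_mul_of_hasSum (a := fun p : MultiIdx r q × MultiIdx r q =>
      innerL2 π f (ψ p.1) * innerL2 π f (ψ p.2))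
    (w := fun p => shrink ρ lam p.1 * shrink ρ lam p.2)
    (fun p => mul_pos (shrink_pos hψ.pos hlam _) (shrink_pos hψ.pos hlam _)) ?_ ?_ hK hK0
  · have h1 : HasSum (fun p : MultiIdx r q × MultiIdx r q =>
        innerL2 π f (ψ p.1) * innerL2 π f (ψ p.2) * empInner x (ψ p.1) (ψ p.2))
        (empInner x f f) := by
      refine ((hasSum_sum fun k _ => HasSum.mul_prod (hψ.hasSum_apply hm hπ hπb hCπ hf (hx k))
        (hψ.hasSum_apply hm hπ hπb hCπ hf (hx k))).mul_left (n : ℝ)⁻¹).congr_fun fun p => ?_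
      simp only [empInner, Finset.mul_sum]
      exact Finset.sum_congr rfl fun k _ => by ring
    have h2 : HasSum (fun p : MultiIdx r q × MultiIdx r q =>
        innerL2 π f (ψ p.1) * innerL2 π f (ψ p.2) * innerL2 π (ψ p.1) (ψ p.2))
        (innerL2 π f f) := by
      have hinj : Function.Injective fun i : MultiIdx r q => (i, i) := fun i j h =>
        (Prod.mk.inj h).1
      refine (hinj.hasSum_iff ?_).1 ((hψ.basis f hf).congr_fun fun i => ?_)
      · intro p hp
        rw [hψ.orthoL2, if_neg, mul_zero]
        exact fun h => hp ⟨p.1, Prod.ext rfl h⟩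
      · simp [hψ.orthoL2, sq]
    exact (h1.sub h2).congr_fun fun p => by ring
  · refine (HasSum.mul_prod hsum hsum).congr_fun fun p => ?_
    rw [div_mul_div_comm]
    ring

/-- The deterministic error bound of the estimator. -/
lemma IsEigensystem.penNormSq_sub_le {n : ℕ} (hn : 0 < n) (hψ : IsEigensystem m q π ρ ψ)
    (hm : 1 ≤ m) (hπ : Measurable π) (hπb : ∀ x ∈ cube r, Cπ⁻¹ ≤ π x ∧ π x ≤ Cπ) (hCπ : 1 ≤ Cπ)
    (hlam : 0 < lam) (hf₀ : f₀ ∈ Hq r m q) {x : Fin n → Fin r → ℝ} (hx : ∀ k, x k ∈ cube r)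
    {ε : Fin n → ℝ} {N : ℝ} (hN0 : 0 ≤ N)
    (hN : ∑' j, ENNReal.ofReal (shrink ρ lam j * empNoise x ε (ψ j) ^ 2) ≤ ENNReal.ofReal N)
    (hK : ∑' p : MultiIdx r q × MultiIdx r q, ENNReal.ofReal (shrink ρ lam p.1 * shrink ρ lam p.2 *
      (empInner x (ψ p.1) (ψ p.2) - innerL2 π (ψ p.1) (ψ p.2)) ^ 2) ≤ ENNReal.ofReal (1 / 4))
    (hfhat : IsKRR m q lam x (fun k => f₀ (x k) + ε k) fhat) :
    penNormSq m q π lam (fun x => fhat x - f₀ x) ≤ 32 * (N + lam * innerHq m q f₀ f₀) := by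
  set Δ : (Fin r → ℝ) → ℝ := fun x => fhat x - f₀ x with hΔ
  have hΔm : Δ ∈ Hq r m q := sub_mem_Hq hm hfhat.1 hf₀
  have hL : 0 ≤ innerL2 π Δ Δ := (hψ.basis Δ hΔm).nonneg fun i => sq_nonneg _
  have hG : 0 ≤ innerHq m q Δ Δ := innerHq_self_nonneg hm hΔm
  have hF : 0 ≤ innerHq m q f₀ f₀ := innerHq_self_nonneg hm hf₀
  have hD0 : 0 ≤ penNormSq m q π lam Δ := add_nonneg hL (mul_nonneg hlam.le hG)
  have hnoise := hψ.empNoise_sq_le hm hπ hπb hCπ hlam hΔm hx hN0 hN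
  have hemp := hψ.empInner_sub_sq_le hm hπ hπb hCπ hlam hΔm hx (by norm_num) hK
  have hpen := innerHq_sub_ge hm hfhat.1 hf₀
  have hn' : (0 : ℝ) < n := by exact_mod_cast hn
  -- Basic inequality: the criterion at `fhat` is at most its value at `f₀`.
  have hbasic : empInner x Δ Δ + lam * (innerHq m q fhat fhat - innerHq m q f₀ f₀) ≤
      2 * empNoise x ε Δ := by
    have hopt := hfhat.2 f₀ hf₀
    have hexp : ∑ k, (f₀ (x k) + ε k - fhat (x k)) ^ 2 =
        ∑ k, (f₀ (x k) + ε k - f₀ (x k)) ^ 2 - 2 * ∑ k, ε k * Δ (x k) +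
          ∑ k, Δ (x k) * Δ (x k) := by
      rw [Finset.mul_sum, ← Finset.sum_sub_distrib, ← Finset.sum_add_distrib]
      exact Finset.sum_congr rfl fun k _ => by simp only [hΔ]; ring
    simp only [krrObjective] at hopt
    rw [hexp] at hopt
    simp only [empInner, empNoise]
    have hinv : 1 / (2 * (n : ℝ)) = (n : ℝ)⁻¹ / 2 := by field_simp
    rw [hinv] at hopt
    linarith
  set D := √(penNormSq m q π lam Δ) with hD
  have hDsq : D ^ 2 = penNormSq m q π lam Δ := Real.sq_sqrt hD0
  have hDnn : 0 ≤ D := Real.sqrt_nonneg _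
  have h1 : empNoise x ε Δ ≤ D * √N := by
    rw [hD, ← Real.sqrt_mul hD0]
    exact Real.le_sqrt_of_sq_le hnoise
  -- The bound 1/4 on the squared Hilbert-Schmidt distance costs half of D², which is absorbed on
  -- the left below.
  have h2 : innerL2 π Δ Δ - empInner x Δ Δ ≤ D ^ 2 / 2 := by
    refine abs_le_of_sq_le_sq' ?_ (by positivity) |>.2
    rw [hDsq]
    linarith
  have h3 : lam * (√(innerHq m q f₀ f₀) * √(innerHq m q Δ Δ)) ≤
      D * √(lam * innerHq m q f₀ f₀) := by
    have : √(lam * innerHq m q Δ Δ) ≤ D := Real.sqrt_le_sqrt (by rw [penNormSq]; linarith)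
    calc lam * (√(innerHq m q f₀ f₀) * √(innerHq m q Δ Δ))
        = √(lam * innerHq m q Δ Δ) * √(lam * innerHq m q f₀ f₀) := by
          rw [Real.sqrt_mul hlam.le, Real.sqrt_mul hlam.le]
          nth_rewrite 1 [← Real.mul_self_sqrt hlam.le]
          ring
      _ ≤ _ := by gcongr
  have h4 := mul_le_mul_of_nonneg_left hpen hlam.le
  -- Adding the estimates gives D² ≤ D²/2 + 2D√N + 2D√(λ‖f₀‖²).
  have hDle : D ≤ 4 * (√N + √(lam * innerHq m q f₀ f₀)) := by
    have hquad : D * D ≤ D * (4 * (√N + √(lam * innerHq m q f₀ f₀))) := by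
      have : D ^ 2 = innerL2 π Δ Δ + lam * innerHq m q Δ Δ := hDsq
      nlinarith
    rcases hDnn.eq_or_lt with h | h
    · rw [← h]; positivity
    · exact le_of_mul_le_mul_left hquad h
  have hsN := Real.sq_sqrt hN0
  have hsF := Real.sq_sqrt (mul_nonneg hlam.le hF)
  rw [← hDsq]
  calc D ^ 2 ≤ (4 * (√N + √(lam * innerHq m q f₀ f₀))) ^ 2 := by gcongr
    _ ≤ 32 * (N + lam * innerHq m q f₀ f₀) := by
      nlinarith [sq_nonneg (√N - √(lam * innerHq m q f₀ f₀))]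

/-- Derivatives are controlled by the penalized norm. -/
lemma IsEigensystem.sq_mixedDer_le (hψ : IsEigensystem m q π ρ ψ) (hm : 1 ≤ m)
    (hπ : Measurable π) (hπb : ∀ x ∈ cube r, Cπ⁻¹ ≤ π x ∧ π x ≤ Cπ) (hCπ : 1 ≤ Cπ)
    (hlam : 0 < lam) (hf : f ∈ Hq r m q) {β : Fin r → ℕ} (hβ : ∀ s, β s ≤ m - 1) {Cψ : ℝ}
    (heig : EigenfunctionAssumption ψ β Cψ) {T : ℝ} (hT0 : 0 ≤ T)
    (hT : ∑' i, ENNReal.ofReal (idxPow i (2 • β) / (1 + lam / ρ i)) ≤ ENNReal.ofReal T)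
    {x : Fin r → ℝ} (hx : x ∈ cube r) :
    mixedDer β f x ^ 2 ≤ penNormSq m q π lam f * (Cψ ^ 2 * T) := by
  refine sq_le_mul_of_hasSum (shrink_pos hψ.pos hlam)
    (hψ.hasSum_mixedDer hm hπ hπb hCπ hf hβ hx)
    (hψ.hasSum_penNormSq hm hπ hπb hCπ hf) ?_ (by positivity)
  rw [ENNReal.ofReal_mul (sq_nonneg _)]
  refine le_trans ?_ (mul_le_mul_right hT _)
  rw [← ENNReal.tsum_mul_left]
  refine ENNReal.tsum_le_tsum fun i => ?_
  rw [← ENNReal.ofReal_mul (sq_nonneg _)]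
  refine ENNReal.ofReal_le_ofReal ?_
  have h1 : mixedDer β (ψ i) x ^ 2 ≤ (Cψ * idxPow i β) ^ 2 := by
    rw [← sq_abs]
    exact pow_le_pow_left₀ (abs_nonneg _) (heig i x hx).2 2
  have h2 : idxPow i (2 • β) = idxPow i β ^ 2 := by
    simp only [idxPow, Pi.smul_apply, smul_eq_mul, ← Finset.prod_pow]
    exact Finset.prod_congr rfl fun k _ => by ring
  rw [h2]
  calc shrink ρ lam i * mixedDer β (ψ i) x ^ 2
      ≤ shrink ρ lam i * (Cψ * idxPow i β) ^ 2 := by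
        gcongr; exact (shrink_pos hψ.pos hlam i).le
    _ = _ := by rw [shrink]; ring

end

section

/-! ### The stochastic part of the error bound -/

variable {Ω : Type*} [MeasurableSpace Ω] {P : Measure Ω}

variable {r : ℕ} {X : Ω → Fin r → ℝ} {ε : Ω → ℝ} {π : (Fin r → ℝ) → ℝ} {Cπ σ Cσ : ℝ}

lemma DistributionAssumption.ae_mem_cube (h : DistributionAssumption P X ε π Cπ σ Cσ) :
    ∀ᵐ ω ∂P, X ω ∈ cube r := by
  have h1 : ∀ᵐ x ∂(P.map X), x ∈ cube r := by
    rw [h.density]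
    exact (withDensity_absolutelyContinuous _ _).ae_le (ae_restrict_mem (measurableSet_cube r))
  exact ae_of_ae_map h.measurable_X.aemeasurable h1

lemma DistributionAssumption.integral_comp (h : DistributionAssumption P X ε π Cπ σ Cσ)
    (hCπ : 1 ≤ Cπ) {g : (Fin r → ℝ) → ℝ} (hg : Measurable g) :
    ∫ ω, g (X ω) ∂P = ∫ x in cube r, g x * π x := by
  rw [← integral_map h.measurable_X.aemeasurable hg.aestronglyMeasurable, h.density,
    integral_withDensity_eq_integral_toReal_smul h.measurable_π.ennreal_ofReal (by simp)]
  refine setIntegral_congr_fun (measurableSet_cube r) fun x hx => ?_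
  have : 0 ≤ π x := le_trans (inv_nonneg.2 (by linarith)) (h.density_bounds x hx).1
  simp only [smul_eq_mul, ENNReal.toReal_ofReal this, mul_comm]

/-- Functions of H_q are controlled on the cube only; cutting them off there makes them measurable
everywhere without changing their values at the sample, almost surely. -/
lemma measurable_indicator_of_continuousOn {f : (Fin r → ℝ) → ℝ} (hf : ContinuousOn f (cube r)) :
    Measurable ((cube r).indicator f) := by
  classical
  rw [← Set.piecewise_eq_indicator]
  exact ContinuousOn.measurable_piecewise hf continuousOn_const (measurableSet_cube r)

variable [IsProbabilityMeasure P]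

/-- The mean square error of an average of pairwise independent variables. -/
lemma lintegral_sq_average_sub_le {Z : ℕ → Ω → ℝ} {n : ℕ} (hn : 0 < n)
    (hZ : ∀ k, MemLp (Z k) 2 P) (hind : Pairwise fun i j => IndepFun (Z i) (Z j) P)
    {c B : ℝ} (hmean : ∀ k, ∫ ω, Z k ω ∂P = c) (hB : ∀ k, ∫ ω, Z k ω ^ 2 ∂P ≤ B) :
    ∫⁻ ω, ENNReal.ofReal (((n : ℝ)⁻¹ * ∑ k : Fin n, Z k ω - c) ^ 2) ∂P ≤
      ENNReal.ofReal (B / n) := by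
  have hn' : (n : ℝ) ≠ 0 := by exact_mod_cast hn.ne'
  set W : Ω → ℝ := fun ω => (n : ℝ)⁻¹ * (∑ k : Fin n, Z k) ω with hW
  have hS : MemLp (∑ k : Fin n, Z k) 2 P := memLp_finsetSum' _ fun k _ => hZ k
  have hWm : MemLp W 2 P := hS.const_mul _
  have hmeanW : ∫ ω, W ω ∂P = c := by
    simp only [hW, integral_const_mul, Finset.sum_apply]
    rw [integral_finsetSum _ fun (k : Fin n) _ => (hZ k).integrable (by norm_num)]
    simp [hmean, hn']
  have hvar : variance W P ≤ B / n := by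
    rw [hW, variance_const_mul, IndepFun.variance_sum (X := fun k : Fin n => Z k)
      (fun k _ => hZ k) (fun i _ j _ hij => hind (fun h => hij (Fin.ext h)))]
    have : ∑ k : Fin n, variance (Z k) P ≤ n * B := by
      refine (Finset.sum_le_card_nsmul _ _ B fun k _ => ?_).trans (by simp)
      exact (variance_le_expectation_sq (hZ k).1).trans (hB k)
    calc (n : ℝ)⁻¹ ^ 2 * ∑ k : Fin n, variance (Z k) P ≤ (n : ℝ)⁻¹ ^ 2 * (n * B) := by gcongr
      _ = B / n := by field_simp
  refine le_trans (le_of_eq ?_) (ENNReal.ofReal_le_ofReal hvar)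
  rw [ofReal_variance hWm, evariance_eq_lintegral_ofReal, hmeanW]
  simp [hW]

/-- If ε² were not integrable, its conditional expectation would be 0 by convention, contradicting
the positive lower bound on the conditional variance. -/
lemma DistributionAssumption.integrable_sq (h : DistributionAssumption P X ε π Cπ σ Cσ)
    (hCσ : 0 < Cσ) : Integrable (fun ω => ε ω ^ 2) P := by
  by_contra hni
  have h1 := h.condVar
  rw [condExp_of_not_integrable hni] at h1
  obtain ⟨ω, hω⟩ := h1.exists
  exact absurd hω (not_le.2 (inv_pos.2 hCσ))

lemma DistributionAssumption.memLp (h : DistributionAssumption P X ε π Cπ σ Cσ)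
    (hCσ : 0 < Cσ) : MemLp ε 2 P :=
  (memLp_two_iff_integrable_sq h.measurable_ε.aestronglyMeasurable).2 (h.integrable_sq hCσ)

lemma DistributionAssumption.integral_sq_le (h : DistributionAssumption P X ε π Cπ σ Cσ) :
    ∫ ω, ε ω ^ 2 ∂P ≤ Cσ ^ 2 := by
  rw [← integral_condExp h.measurable_X.comap_le]
  refine (integral_mono_ae integrable_condExp (integrable_const (Cσ ^ 2))
    (h.condMoment 2 (by simp))).trans (by simp)

lemma DistributionAssumption.memLp_mul (h : DistributionAssumption P X ε π Cπ σ Cσ)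
    (hCσ : 0 < Cσ) {g : (Fin r → ℝ) → ℝ} (hg : Measurable g) {C : ℝ} (hgC : ∀ x, |g x| ≤ C) :
    MemLp (fun ω => ε ω * g (X ω)) 2 P := by
  refine (h.memLp hCσ).of_le_mul (c := C)
    (h.measurable_ε.mul (hg.comp h.measurable_X)).aestronglyMeasurable
    (Eventually.of_forall fun ω => ?_)
  rw [norm_mul, mul_comm]
  exact mul_le_mul_of_nonneg_right (hgC _) (norm_nonneg _)

lemma DistributionAssumption.integral_mul_eq_zero (h : DistributionAssumption P X ε π Cπ σ Cσ)
    (hCσ : 0 < Cσ) {g : (Fin r → ℝ) → ℝ} (hg : Measurable g) {C : ℝ} (hgC : ∀ x, |g x| ≤ C) :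
    ∫ ω, ε ω * g (X ω) ∂P = 0 := by
  have hsm : StronglyMeasurable[MeasurableSpace.comap X inferInstance] fun ω => g (X ω) :=
    (hg.comp (comap_measurable X)).stronglyMeasurable
  have hi := (h.memLp hCσ).integrable (by norm_num)
  have h1 := condExp_stronglyMeasurable_mul_of_bound h.measurable_X.comap_le hsm hi C
    (Eventually.of_forall fun ω => hgC (X ω))
  have h2 : ∫ ω, g (X ω) * ε ω ∂P = 0 := by
    rw [← integral_condExp h.measurable_X.comap_le]
    refine (integral_congr_ae (g := fun _ => 0) ?_).trans (by simp)
    filter_upwards [h1, h.condMean] with ω hω1 hω2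
    have : (P[fun ω => g (X ω) * ε ω | MeasurableSpace.comap X inferInstance]) ω = g (X ω) * _ := hω1
    rw [this, hω2, Pi.zero_apply, mul_zero]
  simpa only [mul_comm] using h2

lemma DistributionAssumption.integral_mul_sq_le (h : DistributionAssumption P X ε π Cπ σ Cσ)
    (hCσ : 0 < Cσ) {g : (Fin r → ℝ) → ℝ} {C : ℝ} (hgC : ∀ x, |g x| ≤ C) :
    ∫ ω, (ε ω * g (X ω)) ^ 2 ∂P ≤ C ^ 2 * Cσ ^ 2 := by
  calc ∫ ω, (ε ω * g (X ω)) ^ 2 ∂P ≤ ∫ ω, C ^ 2 * ε ω ^ 2 ∂P := by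
        refine integral_mono_of_nonneg (Eventually.of_forall fun ω => sq_nonneg _)
          ((h.integrable_sq hCσ).const_mul _) (Eventually.of_forall fun ω => ?_)
        have : g (X ω) ^ 2 ≤ C ^ 2 := by
          rw [← sq_abs]
          exact pow_le_pow_left₀ (abs_nonneg _) (hgC _) 2
        simp only [mul_pow]
        nlinarith [sq_nonneg (ε ω)]
    _ = C ^ 2 * ∫ ω, ε ω ^ 2 ∂P := integral_const_mul _ _
    _ ≤ C ^ 2 * Cσ ^ 2 := by gcongr; exact h.integral_sq_le

end

/-- Tonelli's theorem for nonnegative terms; in `ℝ≥0∞` no summability is needed. -/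
lemma lintegral_tsum_weighted_le {Ω ι : Type*} [MeasurableSpace Ω] [Countable ι] {P : Measure Ω}
    {w : ι → ℝ} (hw : ∀ i, 0 ≤ w i) {A : ι → Ω → ℝ} (hA : ∀ i, Measurable (A i)) {b : ℝ≥0∞}
    (hb : ∀ i, ∫⁻ ω, ENNReal.ofReal (A i ω ^ 2) ∂P ≤ b) :
    ∫⁻ ω, ∑' i, ENNReal.ofReal (w i * A i ω ^ 2) ∂P ≤ (∑' i, ENNReal.ofReal (w i)) * b := by
  rw [lintegral_tsum fun i => (((hA i).pow_const 2).const_mul _).ennreal_ofReal.aemeasurable,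
    ← ENNReal.tsum_mul_right]
  refine ENNReal.tsum_le_tsum fun i => ?_
  simp only [ENNReal.ofReal_mul (hw i)]
  rw [lintegral_const_mul _ ((hA i).pow_const 2).ennreal_ofReal]
  gcongr
  exact hb i

/-! ### Second moments of sample averages -/

section Averages

variable {Ω : Type*} [MeasurableSpace Ω] {P : Measure Ω} {r : ℕ}
    {X : ℕ → Ω → Fin r → ℝ} {ε : ℕ → Ω → ℝ} {π : (Fin r → ℝ) → ℝ} {Cπ σ Cσ : ℝ}

lemma pairwise_indepFun_comp (hindep : iIndepFun (fun i ω => (X i ω, ε i ω)) P)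
    {F : (Fin r → ℝ) × ℝ → ℝ} (hF : Measurable F) :
    Pairwise fun i j => IndepFun (fun ω => F (X i ω, ε i ω)) (fun ω => F (X j ω, ε j ω)) P :=
  fun _ _ hij => (hindep.indepFun hij).comp hF hF

variable [IsProbabilityMeasure P]

lemma lintegral_empInner_sub_sq_le {n : ℕ} (hn : 0 < n)
    (hindep : iIndepFun (fun i ω => (X i ω, ε i ω)) P) (hCπ : 1 ≤ Cπ)
    (hdist : ∀ i, DistributionAssumption P (X i) (ε i) π Cπ σ Cσ)
    {f g : (Fin r → ℝ) → ℝ} (hf : Measurable f) (hg : Measurable g) {C : ℝ}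
    (hfC : ∀ x, |f x| ≤ C) (hgC : ∀ x, |g x| ≤ C) :
    ∫⁻ ω, ENNReal.ofReal ((empInner (fun k : Fin n => X k ω) f g - innerL2 π f g) ^ 2) ∂P ≤
      ENNReal.ofReal (C ^ 4 / n) := by
  have hbound : ∀ x, |f x * g x| ≤ C ^ 2 := fun x => by
    rw [abs_mul, sq]
    exact mul_le_mul (hfC x) (hgC x) (abs_nonneg _) ((abs_nonneg _).trans (hfC x))
  refine lintegral_sq_average_sub_le (Z := fun k ω => f (X k ω) * g (X k ω)) hn (fun k => ?_)
    (pairwise_indepFun_comp hindep (F := fun z => f z.1 * g z.1) (by fun_prop)) (fun k => ?_)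
    fun k => ?_
  · exact MemLp.of_bound ((hf.mul hg).comp (hdist k).measurable_X).aestronglyMeasurable (C ^ 2)
      (Eventually.of_forall fun ω => hbound _)
  · exact (hdist k).integral_comp hCπ (hf.mul hg)
  · refine (integral_mono_of_nonneg (g := fun _ => C ^ 4)
      (Eventually.of_forall fun ω => sq_nonneg _) (integrable_const _)
      (Eventually.of_forall fun ω => ?_)).trans (by simp)
    have := pow_le_pow_left₀ (abs_nonneg _) (hbound (X k ω)) 2
    rw [sq_abs] at this
    exact this.trans_eq (by ring)

lemma lintegral_empNoise_sq_le {n : ℕ} (hn : 0 < n)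
    (hindep : iIndepFun (fun i ω => (X i ω, ε i ω)) P) (hCσ : 0 < Cσ)
    (hdist : ∀ i, DistributionAssumption P (X i) (ε i) π Cπ σ Cσ)
    {f : (Fin r → ℝ) → ℝ} (hf : Measurable f) {C : ℝ} (hfC : ∀ x, |f x| ≤ C) :
    ∫⁻ ω, ENNReal.ofReal (empNoise (fun k : Fin n => X k ω) (fun k => ε k ω) f ^ 2) ∂P ≤
      ENNReal.ofReal (C ^ 2 * Cσ ^ 2 / n) := by
  have h := lintegral_sq_average_sub_le (Z := fun k ω => ε k ω * f (X k ω)) hn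
    (fun k => (hdist k).memLp_mul hCσ hf hfC)
    (pairwise_indepFun_comp hindep (F := fun z => z.2 * f z.1) (by fun_prop))
    (fun k => (hdist k).integral_mul_eq_zero hCσ hf hfC)
    (fun k => (hdist k).integral_mul_sq_le hCσ hfC)
  simp only [sub_zero] at h
  exact h

end Averages

instance {r q : ℕ} : Nonempty (MultiIdx r q) := ⟨⟨fun _ => 1, by simp⟩⟩

lemma idxPow_pos {r q : ℕ} (i : MultiIdx r q) (β : Fin r → ℕ) : 0 < idxPow i β :=
  Finset.prod_pos fun k _ => pow_pos (by exact_mod_cast (i.1 k).pos) _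

lemma tsum_idxPow_ne_zero {r q : ℕ} {ρ : MultiIdx r q → ℝ} (hρ : ∀ i, 0 < ρ i) {lam : ℝ}
    (hlam : 0 < lam) (β : Fin r → ℕ) :
    ∑' i : MultiIdx r q, ENNReal.ofReal (idxPow i β / (1 + lam / ρ i)) ≠ 0 := by
  obtain ⟨i⟩ : Nonempty (MultiIdx r q) := inferInstance
  refine fun h => absurd (ENNReal.tsum_eq_zero.1 h i) (ENNReal.ofReal_pos.2 ?_).ne'
  have := hρ i
  have := idxPow_pos i β
  positivity

lemma indicator_abs_le {r : ℕ} {f : (Fin r → ℝ) → ℝ} {C : ℝ} (hC : 0 ≤ C)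
    (h : ∀ x ∈ cube r, |f x| ≤ C) (x : Fin r → ℝ) : |(cube r).indicator f x| ≤ C := by
  by_cases hx : x ∈ cube r
  · rw [Set.indicator_of_mem hx]; exact h x hx
  · rw [Set.indicator_of_notMem hx]; simpa using hC

lemma innerL2_indicator {r : ℕ} (π f g : (Fin r → ℝ) → ℝ) :
    innerL2 π ((cube r).indicator f) ((cube r).indicator g) = innerL2 π f g := by
  refine setIntegral_congr_fun (measurableSet_cube r) fun x hx => ?_
  simp [Set.indicator_of_mem hx]

lemma empInner_indicator {r n : ℕ} {x : Fin n → Fin r → ℝ} (hx : ∀ k, x k ∈ cube r)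
    (f g : (Fin r → ℝ) → ℝ) :
    empInner x ((cube r).indicator f) ((cube r).indicator g) = empInner x f g := by
  simp only [empInner, Set.indicator_of_mem (hx _)]

lemma empNoise_indicator {r n : ℕ} {x : Fin n → Fin r → ℝ} (hx : ∀ k, x k ∈ cube r)
    (ε : Fin n → ℝ) (f : (Fin r → ℝ) → ℝ) :
    empNoise x ε ((cube r).indicator f) = empNoise x ε f := by
  simp only [empNoise, Set.indicator_of_mem (hx _)]

lemma supNorm_sq_le {r : ℕ} {f : (Fin r → ℝ) → ℝ} {B : ℝ} (h : ∀ x ∈ cube r, f x ^ 2 ≤ B)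
    (hB : 0 ≤ B) : supNorm f ^ 2 ≤ ENNReal.ofReal B := by
  have h1 : supNorm f ≤ ENNReal.ofReal √B :=
    iSup₂_le fun x hx => ENNReal.ofReal_le_ofReal (Real.abs_le_sqrt (h x hx))
  calc supNorm f ^ 2 ≤ ENNReal.ofReal √B ^ 2 := by gcongr
    _ = ENNReal.ofReal B := by
      rw [← ENNReal.ofReal_pow (Real.sqrt_nonneg _), Real.sq_sqrt hB]

/-! ### Expected size of the two stochastic errors -/

section Rate

variable {Ω : Type*} [MeasurableSpace Ω] {P : Measure Ω} [IsProbabilityMeasure P] {r q m : ℕ}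
    {X : ℕ → Ω → Fin r → ℝ} {ε : ℕ → Ω → ℝ} {π : (Fin r → ℝ) → ℝ} {Cπ σ Cσ Cψ : ℝ}
    {ρ : MultiIdx r q → ℝ} {ψ : MultiIdx r q → (Fin r → ℝ) → ℝ} {β : Fin r → ℕ}

/-- The squared Hilbert-Schmidt distance of the empirical and the population covariance operator,
with respect to the penalized norm. -/
def covError (X : ℕ → Ω → Fin r → ℝ) (π : (Fin r → ℝ) → ℝ) (ρ : MultiIdx r q → ℝ)
    (ψ : MultiIdx r q → (Fin r → ℝ) → ℝ) (lam : ℝ) (n : ℕ) (ω : Ω) : ℝ≥0∞ :=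
  ∑' p : MultiIdx r q × MultiIdx r q, ENNReal.ofReal (shrink ρ lam p.1 * shrink ρ lam p.2 *
    (empInner (fun k : Fin n => X k ω) ((cube r).indicator (ψ p.1)) ((cube r).indicator (ψ p.2)) -
      innerL2 π (ψ p.1) (ψ p.2)) ^ 2)

/-- The squared dual norm of the noise with respect to the penalized norm. -/
def noiseError (X : ℕ → Ω → Fin r → ℝ) (ε : ℕ → Ω → ℝ) (ρ : MultiIdx r q → ℝ)
    (ψ : MultiIdx r q → (Fin r → ℝ) → ℝ) (lam : ℝ) (n : ℕ) (ω : Ω) : ℝ≥0∞ :=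
  ∑' j : MultiIdx r q, ENNReal.ofReal (shrink ρ lam j *
    empNoise (fun k : Fin n => X k ω) (fun k => ε k ω) ((cube r).indicator (ψ j)) ^ 2)

lemma measurable_empInner (hX : ∀ i, Measurable (X i)) {f g : (Fin r → ℝ) → ℝ} (hf : Measurable f)
    (hg : Measurable g) (n : ℕ) : Measurable fun ω => empInner (fun k : Fin n => X k ω) f g := by
  unfold empInner
  fun_prop

lemma measurable_empNoise (hX : ∀ i, Measurable (X i)) (hε : ∀ i, Measurable (ε i))
    {f : (Fin r → ℝ) → ℝ} (hf : Measurable f) (n : ℕ) :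
    Measurable fun ω => empNoise (fun k : Fin n => X k ω) (fun k => ε k ω) f := by
  unfold empNoise
  fun_prop

lemma IsEigensystem.measurable_indicator (hψ : IsEigensystem m q π ρ ψ) (hm : 1 ≤ m)
    (i : MultiIdx r q) : Measurable ((cube r).indicator (ψ i)) :=
  measurable_indicator_of_continuousOn (continuousOn_of_mem_Hq hm (hψ.mem i))

lemma EigenfunctionAssumption.indicator_abs_le (heig : EigenfunctionAssumption ψ β Cψ)
    (hCψ : 0 < Cψ) (i : MultiIdx r q) (x : Fin r → ℝ) : |(cube r).indicator (ψ i) x| ≤ Cψ :=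
  SSANOVA.indicator_abs_le hCψ.le (fun x hx => (heig i x hx).1) x

lemma measurable_covError (hm : 1 ≤ m) (hX : ∀ i, Measurable (X i))
    (hψ : IsEigensystem m q π ρ ψ) (lam : ℝ) (n : ℕ) : Measurable (covError X π ρ ψ lam n) := by
  refine Measurable.tsum fun p => Measurable.ennreal_ofReal ?_
  exact (((measurable_empInner hX (hψ.measurable_indicator hm _)
    (hψ.measurable_indicator hm _) n).sub_const
      _).pow_const 2).const_mul _

lemma measurable_noiseError (hm : 1 ≤ m) (hX : ∀ i, Measurable (X i)) (hε : ∀ i, Measurable (ε i))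
    (hψ : IsEigensystem m q π ρ ψ) (lam : ℝ) (n : ℕ) : Measurable (noiseError X ε ρ ψ lam n) := by
  refine Measurable.tsum fun p => Measurable.ennreal_ofReal ?_
  exact ((measurable_empNoise hX hε (hψ.measurable_indicator hm _) n).pow_const
      2).const_mul _

/-- Each entry has mean square at most Cψ⁴/n, and the product weights sum to the square of the sum
of the single weights. -/
lemma lintegral_covError_le (hm : 1 ≤ m) (hindep : iIndepFun (fun i ω => (X i ω, ε i ω)) P)
    (hCπ : 1 ≤ Cπ) (hdist : ∀ i, DistributionAssumption P (X i) (ε i) π Cπ σ Cσ)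
    (hψ : IsEigensystem m q π ρ ψ) (hCψ : 0 < Cψ) (heig : EigenfunctionAssumption ψ β Cψ)
    {n : ℕ} (hn : 0 < n) {lam : ℝ} (hlam : 0 < lam) :
    ∫⁻ ω, covError X π ρ ψ lam n ω ∂P ≤
      (∑' i, ENNReal.ofReal (shrink ρ lam i)) ^ 2 * ENNReal.ofReal (Cψ ^ 4 / n) := by
  have hw : ∀ i, 0 ≤ shrink ρ lam i := fun i => (shrink_pos hψ.pos hlam i).le
  have hS : ∑' p : MultiIdx r q × MultiIdx r q,
      ENNReal.ofReal (shrink ρ lam p.1 * shrink ρ lam p.2) =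
      (∑' i, ENNReal.ofReal (shrink ρ lam i)) ^ 2 := by
    rw [ENNReal.tsum_prod', sq, ← ENNReal.tsum_mul_right]
    refine tsum_congr fun i => ?_
    rw [← ENNReal.tsum_mul_left]
    exact tsum_congr fun j => ENNReal.ofReal_mul (hw i)
  rw [← hS]
  refine lintegral_tsum_weighted_le (w := fun p : MultiIdx r q × MultiIdx r q =>
      shrink ρ lam p.1 * shrink ρ lam p.2)
    (A := fun p ω => empInner (fun k : Fin n => X k ω) ((cube r).indicator (ψ p.1))
      ((cube r).indicator (ψ p.2)) - innerL2 π (ψ p.1) (ψ p.2))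
    (fun p => mul_nonneg (hw _) (hw _))
    (fun p => (measurable_empInner (fun i => (hdist i).measurable_X)
      (hψ.measurable_indicator hm p.1) (hψ.measurable_indicator hm p.2) n).sub_const _)
    fun p => ?_
  rw [← innerL2_indicator π (ψ p.1) (ψ p.2)]
  exact lintegral_empInner_sub_sq_le hn hindep hCπ hdist (hψ.measurable_indicator hm p.1)
    (hψ.measurable_indicator hm p.2) (heig.indicator_abs_le hCψ p.1)
    (heig.indicator_abs_le hCψ p.2)

lemma lintegral_noiseError_le (hm : 1 ≤ m) (hindep : iIndepFun (fun i ω => (X i ω, ε i ω)) P)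
    (hCσ : 0 < Cσ) (hdist : ∀ i, DistributionAssumption P (X i) (ε i) π Cπ σ Cσ)
    (hψ : IsEigensystem m q π ρ ψ) (hCψ : 0 < Cψ) (heig : EigenfunctionAssumption ψ β Cψ)
    {n : ℕ} (hn : 0 < n) {lam : ℝ} (hlam : 0 < lam) :
    ∫⁻ ω, noiseError X ε ρ ψ lam n ω ∂P ≤
      (∑' i, ENNReal.ofReal (shrink ρ lam i)) * ENNReal.ofReal (Cψ ^ 2 * Cσ ^ 2 / n) :=
  lintegral_tsum_weighted_le (w := shrink ρ lam)
    (A := fun j ω => empNoise (fun k : Fin n => X k ω) (fun k => ε k ω) ((cube r).indicator (ψ j)))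
    (fun i => (shrink_pos hψ.pos hlam i).le)
    (fun i => measurable_empNoise (fun i => (hdist i).measurable_X)
      (fun i => (hdist i).measurable_ε) (hψ.measurable_indicator hm i) n)
    fun i => lintegral_empNoise_sq_le hn hindep hCσ hdist (hψ.measurable_indicator hm i)
      (heig.indicator_abs_le hCψ i)

end Rate

/-! ### From small stochastic errors to the supremum norm -/

section Assembly

variable {Ω : Type*} {r q m : ℕ}
    {X : ℕ → Ω → Fin r → ℝ} {ε : ℕ → Ω → ℝ} {π : (Fin r → ℝ) → ℝ} {Cπ Cψ : ℝ}
    {ρ : MultiIdx r q → ℝ} {ψ : MultiIdx r q → (Fin r → ℝ) → ℝ} {β : Fin r → ℕ}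
    {f₀ fhat : (Fin r → ℝ) → ℝ} {lam : ℝ} {n : ℕ}

lemma tsum_idxPow_zero (ρ : MultiIdx r q → ℝ) (lam : ℝ) :
    ∑' i : MultiIdx r q, ENNReal.ofReal (idxPow i 0 / (1 + lam / ρ i)) =
      ∑' i, ENNReal.ofReal (shrink ρ lam i) := by
  simp [idxPow, shrink]

/-- The error bound on the event where the two stochastic error terms are small. -/
lemma supNorm_sq_le_of_errors_le (hm : 1 ≤ m) (hn : 0 < n) (hlam : 0 < lam) (hπ : Measurable π)
    (hπb : ∀ x ∈ cube r, Cπ⁻¹ ≤ π x ∧ π x ≤ Cπ) (hCπ : 1 ≤ Cπ) (hψ : IsEigensystem m q π ρ ψ)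
    (hβ : ∀ s, β s ≤ m - 1) (heig : EigenfunctionAssumption ψ β Cψ) (hf₀ : f₀ ∈ Hq r m q) {ω : Ω}
    (hX : ∀ k, X k ω ∈ cube r) {N t : ℝ} (hN0 : 0 ≤ N) (ht0 : 0 ≤ t)
    (hcov : covError X π ρ ψ lam n ω ≤ ENNReal.ofReal (1 / 4))
    (hnoise : noiseError X ε ρ ψ lam n ω ≤ ENNReal.ofReal N)
    (ht : ∑' i, ENNReal.ofReal (idxPow i (2 • β) / (1 + lam / ρ i)) ≤ ENNReal.ofReal t)
    (hfhat : IsKRR m q lam (fun k : Fin n => X k ω) (fun k => f₀ (X k ω) + ε k ω) fhat) :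
    supNorm (fun x => mixedDer β fhat x - mixedDer β f₀ x) ^ 2 ≤
      ENNReal.ofReal (32 * (N + lam * innerHq m q f₀ f₀) * (Cψ ^ 2 * t)) := by
  have hF := innerHq_self_nonneg hm hf₀
  simp only [covError, empInner_indicator (x := fun k : Fin n => X k ω) (fun k => hX k)] at hcov
  simp only [noiseError, empNoise_indicator (x := fun k : Fin n => X k ω) (fun k => hX k)] at hnoise
  have hpen := hψ.penNormSq_sub_le hn hm hπ hπb hCπ hlam hf₀ (fun k => hX k) hN0 hnoise hcov hfhat
  refine supNorm_sq_le (fun x hx => ?_) (by positivity)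
  rw [← mixedDer_sub hm hfhat.1 hf₀ hβ hx]
  refine (hψ.sq_mixedDer_le hm hπ hπb hCπ hlam (sub_mem_Hq hm hfhat.1 hf₀) hβ heig ht0 ht
    hx).trans ?_
  gcongr

/-- Only s must avoid 0 and ∞ for the inverses to split; t is arbitrary. -/
lemma inv_mul_inv_inv_mul_inv {n : ℕ} (hn : 0 < n) {s t : ℝ≥0∞} (hs : s ≠ 0) (hs' : s ≠ ∞) :
    1 / ((n : ℝ≥0∞) * s⁻¹ * t⁻¹) = (n : ℝ≥0∞)⁻¹ * s * t := by
  have hn' : (n : ℝ≥0∞) ≠ 0 := by exact_mod_cast hn.ne'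
  have h1 : (n : ℝ≥0∞) * s⁻¹ ≠ 0 := mul_ne_zero hn' (ENNReal.inv_ne_zero.2 hs')
  have h2 : (n : ℝ≥0∞) * s⁻¹ ≠ ∞ :=
    ENNReal.mul_ne_top (ENNReal.natCast_ne_top n) (ENNReal.inv_ne_top.2 hs)
  rw [one_div, ENNReal.mul_inv (Or.inl h1) (Or.inl h2),
    ENNReal.mul_inv (Or.inl hn') (Or.inl (ENNReal.natCast_ne_top n)), inv_inv, inv_inv]

end Assembly

end

end SSANOVA

/-! ### The rate in probability -/

open SSANOVA in
theorem theorem1 {Ω : Type*} [MeasurableSpace Ω] (P : Measure Ω) [IsProbabilityMeasure P]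
    (r q m : ℕ) (hq : 1 ≤ q) (hqr : q ≤ r) (hm : 1 ≤ m)
    (X : ℕ → Ω → Fin r → ℝ) (ε Y : ℕ → Ω → ℝ) (f₀ : (Fin r → ℝ) → ℝ)
    (hf₀ : f₀ ∈ SSANOVA.Hq r m q)
    (hY : ∀ i ω, Y i ω = f₀ (X i ω) + ε i ω)
    (hindep : iIndepFun (fun i ω => (X i ω, ε i ω)) P)
    (hident : ∀ i, IdentDistrib (fun ω => (X i ω, ε i ω)) (fun ω => (X 0 ω, ε 0 ω)) P P)
    (π : (Fin r → ℝ) → ℝ) (Cπ σ Cσ : ℝ) (hCπ : 1 ≤ Cπ) (hσ : 0 < σ) (hCσ : 0 < Cσ)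
    (hdist : ∀ i, SSANOVA.DistributionAssumption P (X i) (ε i) π Cπ σ Cσ)
    (ρ : SSANOVA.MultiIdx r q → ℝ) (ψ : SSANOVA.MultiIdx r q → (Fin r → ℝ) → ℝ)
    (hψ : SSANOVA.IsEigensystem m q π ρ ψ)
    (β : Fin r → ℕ) (hβ : ∀ s, β s ≤ m - 1)
    (Cψ : ℝ) (hCψ : 0 < Cψ) (heig : SSANOVA.EigenfunctionAssumption ψ β Cψ)
    (lam : ℕ → ℝ) (hlam : ∀ n, 0 < lam n) (hlam0 : Tendsto lam atTop (𝓝 0))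
    (hnh : Tendsto (fun n : ℕ => (n : ℝ≥0∞) * SSANOVA.hh ρ (lam n) 0 ^ 2) atTop (𝓝 ∞))
    (fhat : ℕ → Ω → (Fin r → ℝ) → ℝ)
    (hfhat : ∀ n, ∀ᵐ ω ∂P, SSANOVA.IsKRR m q (lam n) (fun i : Fin n => X i ω)
      (fun i : Fin n => Y i ω) (fhat n ω)) :
    SSANOVA.IsBigOP P
      (fun n ω => SSANOVA.supNorm
        (fun x => SSANOVA.mixedDer β (fhat n ω) x - SSANOVA.mixedDer β f₀ x) ^ 2)
      (fun n => ENNReal.ofReal (lam n) / SSANOVA.hh ρ (lam n) (2 • β) +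
        1 / ((n : ℝ≥0∞) * SSANOVA.hh ρ (lam n) 0 * SSANOVA.hh ρ (lam n) (2 • β))) := by
  intro δ hδ
  -- A finite positive d below δ/2 is chosen because δ itself may be ∞.
  obtain ⟨d, hd0, hdδ⟩ := ENNReal.lt_iff_exists_nnreal_btwn.1 (ENNReal.half_pos hδ.ne')
  have hd : (0 : ℝ) < d := by exact_mod_cast hd0
  have hF := innerHq_self_nonneg hm hf₀
  set F := innerHq m q f₀ f₀
  set c : ℝ := Cψ ^ 2 * Cσ ^ 2 with hc_def
  have hc : 0 < c := by positivity
  set C : ℝ := 32 * Cψ ^ 2 * (c / d + F) + 1 with hC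
  have hC0 : 0 < C := by positivity
  have hlim : Tendsto (fun n : ℕ => 4 * ENNReal.ofReal (Cψ ^ 4) *
      ((n : ℝ≥0∞) * hh ρ (lam n) 0 ^ 2)⁻¹) atTop (𝓝 0) := by
    have h := ENNReal.Tendsto.const_mul (a := 4 * ENNReal.ofReal (Cψ ^ 4))
      (tendsto_inv_iff.2 hnh) (Or.inr (by finiteness))
    simpa using h
  refine ⟨C.toNNReal, ?_⟩
  filter_upwards [hlim.eventually_lt_const (ENNReal.half_pos hδ.ne'),
    hnh.eventually_ne ENNReal.top_ne_zero, eventually_gt_atTop 0] with n hnlim hnh0 hn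
  have hn' : (0 : ℝ) < n := by exact_mod_cast hn
  set S := ∑' i, ENNReal.ofReal (shrink ρ (lam n) i) with hS
  have hhS : hh ρ (lam n) 0 = S⁻¹ := by rw [hh, tsum_idxPow_zero]
  have hS0 : S ≠ 0 := by
    rw [hS, ← tsum_idxPow_zero]
    exact tsum_idxPow_ne_zero hψ.pos (hlam n) 0
  -- Divergence would mean h = 0, which is excluded for large n by n h² → ∞.
  have hStop : S ≠ ∞ := by
    rintro h
    rw [hhS, h] at hnh0
    simp at hnh0
  obtain ⟨s, hs, hsS⟩ : ∃ s : ℝ, 0 < s ∧ ENNReal.ofReal s = S :=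
    ⟨S.toReal, ENNReal.toReal_pos hS0 hStop, ENNReal.ofReal_toReal hStop⟩
  set T := ∑' i : MultiIdx r q, ENNReal.ofReal (idxPow i (2 • β) / (1 + lam n / ρ i)) with hT
  have hhT : hh ρ (lam n) (2 • β) = T⁻¹ := rfl
  rw [hhS, hhT, inv_mul_inv_inv_mul_inv hn hS0 hStop, div_eq_mul_inv, inv_inv]
  -- If the sum for 2β diverges, the claimed rate is ∞ because λ > 0, and nothing remains to be
  -- shown.
  by_cases hTtop : T = ∞
  · have htop : ENNReal.ofReal (lam n) * T = ∞ := by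
      rw [hTtop, ENNReal.mul_top (ENNReal.ofReal_pos.2 (hlam n)).ne']
    have hCtop : ((C.toNNReal : ℝ≥0) : ℝ≥0∞) * ∞ = ∞ :=
      ENNReal.mul_top (ENNReal.ofReal_pos.2 hC0).ne'
    rw [htop, top_add, hCtop]
    simp
  obtain ⟨t, ht, htT⟩ : ∃ t : ℝ, 0 ≤ t ∧ ENNReal.ofReal t = T :=
    ⟨T.toReal, ENNReal.toReal_nonneg, ENNReal.ofReal_toReal hTtop⟩
  -- The mean of the noise error is at most c s / n, so Markov's inequality at this level gives
  -- probability at most d.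
  set N : ℝ := c / d * s / n with hN
  have hN0 : 0 < N := by positivity
  -- Markov's inequality at level 1/4 gives 4 Cψ⁴ / (n h²), which `hlim` makes small.
  have hcov : P {ω | ENNReal.ofReal (1 / 4) ≤ covError X π ρ ψ (lam n) n ω} ≤ δ / 2 := by
    refine (meas_ge_le_lintegral_div (measurable_covError hm (fun i => (hdist i).measurable_X) hψ
      _ _).aemeasurable (by simp) (by simp)).trans ?_
    refine le_trans ?_ hnlim.le
    have h4 : ENNReal.ofReal (1 / 4) = 4⁻¹ := by
      rw [one_div, ENNReal.ofReal_inv_of_pos (by norm_num)]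
      norm_num
    rw [h4, div_eq_mul_inv, inv_inv, hhS, mul_comm]
    refine (mul_le_mul_right (lintegral_covError_le hm hindep hCπ hdist hψ hCψ heig hn
      (hlam n)) 4).trans (le_of_eq ?_)
    rw [← hS, ENNReal.ofReal_div_of_pos hn', ENNReal.ofReal_natCast, ENNReal.mul_inv
      (Or.inl (by exact_mod_cast hn.ne')) (Or.inl (ENNReal.natCast_ne_top n)), ENNReal.inv_pow,
      inv_inv, div_eq_mul_inv]
    ring
  have hnoise : P {ω | ENNReal.ofReal N ≤ noiseError X ε ρ ψ (lam n) n ω} ≤ δ / 2 := by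
    refine (meas_ge_le_lintegral_div (measurable_noiseError hm (fun i => (hdist i).measurable_X)
      (fun i => (hdist i).measurable_ε) hψ _ _).aemeasurable (ENNReal.ofReal_pos.2 hN0).ne'
      (by simp)).trans ?_
    refine le_trans ?_ hdδ.le
    refine (ENNReal.div_le_div_right (lintegral_noiseError_le hm hindep hCσ hdist hψ hCψ heig hn
      (hlam n)) _).trans (le_of_eq ?_)
    rw [← hS, ← hsS, ← ENNReal.ofReal_mul hs.le, ← ENNReal.ofReal_div_of_pos hN0,
      ← ENNReal.ofReal_coe_nnreal]
    congr 1
    rw [hN, hc_def]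
    field_simp
  have hcube : ∀ᵐ ω ∂P, ∀ k, X k ω ∈ cube r := ae_all_iff.2 fun k => (hdist k).ae_mem_cube
  calc P _ ≤ P ({ω | ENNReal.ofReal (1 / 4) ≤ covError X π ρ ψ (lam n) n ω} ∪
        {ω | ENNReal.ofReal N ≤ noiseError X ε ρ ψ (lam n) n ω}) := by
        -- The event on the left need not be measurable: almost sure inclusion in the two
        -- exceptional events suffices.
        refine measure_mono_ae ?_
        filter_upwards [hcube, hfhat n] with ω hX hkrr hbad
        by_contra hgood
        have hgood₁ : covError X π ρ ψ (lam n) n ω < ENNReal.ofReal (1 / 4) :=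
          lt_of_not_ge fun h => hgood (Or.inl h)
        have hgood₂ : noiseError X ε ρ ψ (lam n) n ω < ENNReal.ofReal N :=
          lt_of_not_ge fun h => hgood (Or.inr h)
        refine absurd hbad (not_lt.2 ?_)
        simp only [hY] at hkrr
        refine (supNorm_sq_le_of_errors_le hm hn (hlam n) (hdist 0).measurable_π
          (hdist 0).density_bounds hCπ hψ hβ heig hf₀ hX hN0.le ht hgood₁.le hgood₂.le
          htT.ge hkrr).trans ?_
        rw [← htT, ← hsS, ← ENNReal.ofReal_natCast, ← ENNReal.ofReal_inv_of_pos hn',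
          ← ENNReal.ofReal_mul (hlam n).le, ← ENNReal.ofReal_mul (by positivity),
          ← ENNReal.ofReal_mul (by positivity), ← ENNReal.ofReal_add
            (mul_nonneg (hlam n).le ht) (by positivity)]
        change _ ≤ ENNReal.ofReal C * _
        rw [← ENNReal.ofReal_mul hC0.le]
        refine ENNReal.ofReal_le_ofReal ?_
        have h1 : 0 ≤ lam n * t := mul_nonneg (hlam n).le ht
        have h2 : 0 ≤ (n : ℝ)⁻¹ * s * t := by positivity
        have hcd : 0 ≤ c / d := by positivity
        have e1 : 32 * (N + lam n * F) * (Cψ ^ 2 * t) =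
            32 * Cψ ^ 2 * (c / d) * ((n : ℝ)⁻¹ * s * t) + 32 * Cψ ^ 2 * F * (lam n * t) := by
          rw [hN]; ring
        have e2 : C * (lam n * t + (n : ℝ)⁻¹ * s * t) =
            32 * Cψ ^ 2 * (c / d) * ((n : ℝ)⁻¹ * s * t) + 32 * Cψ ^ 2 * F * (lam n * t) +
            (32 * Cψ ^ 2 * (c / d) * (lam n * t) + 32 * Cψ ^ 2 * F * ((n : ℝ)⁻¹ * s * t) +
              lam n * t + (n : ℝ)⁻¹ * s * t) := by
          rw [hC]; ring
        have h3 : 0 ≤ 32 * Cψ ^ 2 * (c / d) * (lam n * t) := by positivity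
        have h4 : 0 ≤ 32 * Cψ ^ 2 * F * ((n : ℝ)⁻¹ * s * t) := by positivity
        rw [e1, e2]
        linarith
    _ ≤ δ / 2 + δ / 2 := (measure_union_le _ _).trans (add_le_add hcov hnoise)
    _ = δ := ENNReal.add_halves δ
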